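/- Consider three spins with state space $(\mathbb C^2)^{\otimes 3}$ and Schrödinger equation $i\dot\psi=\big((1-u)H_0+uH_1\big)\psi$, where $H_0=\sigma_z^1\sigma_z^2+\sigma_z^2\sigma_z^3+\sigma_z^3\sigma_z^1$, $H_1=\sigma_x^1+\sigma_x^2+\sigma_x^3$, and $u=u(t)$ is a real control. Admissible controls form any class $\mathcal U$ of functions that contains all piecewise constant functions (finitely many switches) with values in $\{0,1\}$. A state is reachable from $\psi_0$ if it equals $\psi(T)$ for some $T\ge 0$ and some Carathéodory solution $\psi$ on $[0,T]$ with $\psi(0)=\psi_0$ and a control $u\in\mathcal U$ integrable on $[0,T]$. Let $$\phi_0=|000\rangle,\quad \phi_1=|111\rangle,\quad \phi_2=\tfrac1{\sqrt3}(|100\rangle+|010\rangle+|001\rangle),\quad \phi_3=\tfrac1{\sqrt3}(|011\rangle+|101\rangle+|110\rangle)$$ be the Dicke states. Write $\mathbb C^4=\mathbb C^2\otimes\mathbb C^2$ for the coordinates in $(\phi_0,\phi_1,\phi_2,\phi_3)$, with $e\otimes f=(e_0f_0,e_0f_1,e_1f_0,e_1f_1)$, and put $f_\pm=\frac1{\sqrt2}(1,\pm1)$.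 Let $V_1=\{e\otimes f_+ : e\in\mathbb C^2\}$ and $V_2=\{e\otimes f_-: e\in\mathbb C^2\}$. Then: 1. The Dicke states span the space of permutation-invariant states (the symmetric sector). This space is the direct sum $V_1\oplus V_2$, and $V_1$, $V_2$ are invariant under $(1-u)H_0+uH_1$ for every $u\in\mathbb R$. 2. The set of states reachable from $|000\rangle$ is exactly the set of states whose coordinate vector in the Dicke basis lies in $$\mathcal O=\left\{\frac{e^{i\mu}}2\begin{pmatrix}e^{i\phi}\cos\theta\\ e^{i\phi}\cos\theta\\ e^{i\zeta}\sin\theta\\ e^{i\zeta}\sin\theta\end{pmatrix}+\frac{e^{-i\mu}}2\begin{pmatrix}e^{i\alpha}\cos\gamma\\ -e^{i\alpha}\cos\gamma\\ e^{i\beta}\sin\gamma\\ -e^{i\beta}\sin\gamma\end{pmatrix} : \phi,\zeta,\theta,\alpha,\beta,\gamma,\mu\in\mathbb R\right\}.$$ 3. All these states are unit vectors of the symmetric sector, but not every unit vector of the symmetric sector is of this form, even up to a global phase. 4. A vector $v\in\mathbb C^4$ lies in $\mathcal O$ if and only if $v=\frac1{\sqrt2}e_1\otimes f_++\frac1{\sqrt2}e_2\otimes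 f_-$ for some unit vectors $e_1,e_2\in\mathbb C^2$ (not necessarily orthogonal). Moreover, if $v\in\mathcal O$ and $v=r_1e_1\otimes f_++r_2e_2\otimes f_-$ with unit vectors $e_1,e_2$ and $r_1,r_2\ge0$, then $r_1=r_2=\frac1{\sqrt2}$. That is, the coefficients in the decomposition along the two invariant subspaces are equal. 5. Let $\tau=C_{A(BC)}^2-C_{AB}^2-C_{AC}^2$ be the three-tangle of a pure state of three qubits, where $C_{A(BC)}^2=4\det\rho_A$ and $C_{AB},C_{AC}$ are Wootters' concurrences of the two-qubit reduced states. Then $\tau\le1$ for all unit vectors. For every $\theta\in\mathbb R$ the coordinate vector $(\cos\theta,0,0,\sin\theta)$ lies in $\mathcal O$, and the tangle of the corresponding state is $\tau=\frac{16}{3\sqrt3}|\cos\theta\,\sin^3\theta|$. This equals $1$ if and only if $|\sin\theta|=\frac{\sqrt3}2$. In particular, states of maximal three-tangle $1$ are reachable from $|000\rangle$. -/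

import Mathlib

open scoped Matrix Kronecker
open MeasureTheory

noncomputable section

namespace IsingChain

/-! ### The controlled Ising spin chain -/

def σx : Matrix (Fin 2) (Fin 2) ℂ := !![0, 1; 1, 0]

def σy : Matrix (Fin 2) (Fin 2) ℂ := !![0, Complex.I; -Complex.I, 0]

def σz : Matrix (Fin 2) (Fin 2) ℂ := !![1, 0; 0, -1]

/-- State vectors of `n` spins in the computational basis: a basis state is a bit string. -/
abbrev State (n : ℕ) : Type := (Fin n → Fin 2) → ℂ

/-- Tensor product over the sites with factor `σ` at site `j` and the identity elsewhere. -/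
def siteOp {n : ℕ} (j : Fin n) (σ : Matrix (Fin 2) (Fin 2) ℂ) :
    Matrix (Fin n → Fin 2) (Fin n → Fin 2) ℂ :=
  fun a b => ∏ k, (if k = j then σ else 1) (a k) (b k)

/-- Nearest neighbour coupling on the closed chain (`j + 1` is taken cyclically in `Fin n`). -/
def H₀ (n : ℕ) [NeZero n] : Matrix (Fin n → Fin 2) (Fin n → Fin 2) ℂ :=
  ∑ j : Fin n, siteOp j σz * siteOp (j + 1) σz

/-- Transverse field. -/
def H₁ (n : ℕ) : Matrix (Fin n → Fin 2) (Fin n → Fin 2) ℂ :=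
  ∑ j : Fin n, siteOp j σx

/-- The Hamiltonian `(1 - u) H₀ + u H₁` at control value `u`. -/
def hamiltonian (n : ℕ) [NeZero n] (u : ℝ) : Matrix (Fin n → Fin 2) (Fin n → Fin 2) ℂ :=
  ((1 - u : ℝ) : ℂ) • H₀ n + (u : ℂ) • H₁ n

/-- `ψ` is a (Carathéodory) solution on `[0, T]` of the Schrödinger equation
`i ψ' = H(u(t)) ψ` driven by the integrable control `u`. -/
structure IsTrajectory (n : ℕ) [NeZero n] (u : ℝ → ℝ) (T : ℝ) (ψ : ℝ → State n) : Prop where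
  integrable : IntervalIntegrable u volume 0 T
  continuousOn : ContinuousOn ψ (Set.Icc 0 T)
  eq_integral : ∀ t ∈ Set.Icc 0 T,
    ψ t = ψ 0 + ∫ s in (0 : ℝ)..t, (-Complex.I) • (hamiltonian n (u s) *ᵥ ψ s)

/-- States that can be reached from `ψ₀` in some time `T ≥ 0` by a control of the class `𝒰`. -/
def reachableSet (n : ℕ) [NeZero n] (𝒰 : Set (ℝ → ℝ)) (ψ₀ : State n) : Set (State n) :=
  {χ | ∃ u ∈ 𝒰, ∃ T : ℝ, 0 ≤ T ∧ ∃ ψ : ℝ → State n,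
    IsTrajectory n u T ψ ∧ ψ 0 = ψ₀ ∧ ψ T = χ}

/-- Piecewise constant with finitely many switching times. -/
def IsPiecewiseConstant (u : ℝ → ℝ) : Prop :=
  ∃ F : Finset ℝ, ∀ s t, s ≤ t → Disjoint (Set.Icc s t) (F : Set ℝ) → u s = u t

/-! ### The symmetric sector of three spins -/

/-- Unit vector for the Hermitian norm. -/
def IsUnitVector {ι : Type*} [Fintype ι] (v : ι → ℂ) : Prop := ∑ i, ‖v i‖ ^ 2 = 1

/-- The vector `|a b c⟩` of the computational basis. -/
def ket (a b c : Fin 2) : State 3 := Pi.single ![a, b, c] 1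

/-- The normalized Dicke states. -/
def dicke : Fin 4 → State 3 :=
  ![ket 0 0 0,
    ket 1 1 1,
    ((1 / √3 : ℝ) : ℂ) • (ket 1 0 0 + ket 0 1 0 + ket 0 0 1),
    ((1 / √3 : ℝ) : ℂ) • (ket 0 1 1 + ket 1 0 1 + ket 1 1 0)]

/-- The state with coordinates `v` in the basis of the Dicke states. -/
def ofDicke (v : Fin 4 → ℂ) : State 3 := ∑ i, v i • dicke i

/-- The states that are invariant under all permutations of the spins. -/
def symmetricSector : Submodule ℂ (State 3) where
  carrier := {ψ | ∀ (π : Equiv.Perm (Fin 3)) (a : Fin 3 → Fin 2), ψ (a ∘ π) = ψ a}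
  add_mem' := fun hx hy π a => by simp only [Pi.add_apply, hx π a, hy π a]
  zero_mem' := fun _ _ => rfl
  smul_mem' := fun c x hx π a => by simp only [Pi.smul_apply, hx π a]

/-- Coordinates of `e ⊗ f` under the identification `ℂ⁴ = ℂ² ⊗ ℂ²`. -/
def tensor (e f : Fin 2 → ℂ) : Fin 4 → ℂ := ![e 0 * f 0, e 0 * f 1, e 1 * f 0, e 1 * f 1]

/-- The unit vector `(1, 1) / √2`. -/
def fPlus : Fin 2 → ℂ := ![((1 / √2 : ℝ) : ℂ), ((1 / √2 : ℝ) : ℂ)]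

/-- The unit vector `(1, -1) / √2`. -/
def fMinus : Fin 2 → ℂ := ![((1 / √2 : ℝ) : ℂ), -((1 / √2 : ℝ) : ℂ)]

/-- The subspace `{v ⊗ f | v ∈ ℂ²}` of the symmetric sector. -/
def sectorSubspace (f : Fin 2 → ℂ) : Submodule ℂ (State 3) :=
  Submodule.span ℂ (Set.range fun v : Fin 2 → ℂ => ofDicke (tensor v f))

def V₁ : Submodule ℂ (State 3) := sectorSubspace fPlus

def V₂ : Submodule ℂ (State 3) := sectorSubspace fMinus

/-- The phase `e^{i x}`. -/
def phase (x : ℝ) : ℂ := Complex.exp (Complex.I * x)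

/-- The explicit set of coordinate vectors in the basis of the Dicke states. -/
def setO : Set (Fin 4 → ℂ) :=
  {v | ∃ φ ζ θ α β γ μ : ℝ,
    v = (phase μ / 2) • ![phase φ * Real.cos θ, phase φ * Real.cos θ,
          phase ζ * Real.sin θ, phase ζ * Real.sin θ]
      + (phase (-μ) / 2) • ![phase α * Real.cos γ, -(phase α * Real.cos γ),
          phase β * Real.sin γ, -(phase β * Real.sin γ)]}

/-! ### Distributed entanglement -/

/-- Reduced density matrix of the first spin. -/
def reducedA (ψ : State 3) : Matrix (Fin 2) (Fin 2) ℂ :=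
  fun i j => ∑ k, ∑ l, ψ ![i, k, l] * star (ψ ![j, k, l])

/-- Reduced density matrix of the first and second spin. -/
def reducedAB (ψ : State 3) : Matrix (Fin 2 × Fin 2) (Fin 2 × Fin 2) ℂ :=
  fun p q => ∑ m, ψ ![p.1, p.2, m] * star (ψ ![q.1, q.2, m])

/-- Reduced density matrix of the first and third spin. -/
def reducedAC (ψ : State 3) : Matrix (Fin 2 × Fin 2) (Fin 2 × Fin 2) ℂ :=
  fun p q => ∑ m, ψ ![p.1, m, p.2] * star (ψ ![q.1, m, q.2])

/-- Spin-flipped density matrix `(σ_y ⊗ σ_y) ρ̄ (σ_y ⊗ σ_y)`. -/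
def spinFlip (ρ : Matrix (Fin 2 × Fin 2) (Fin 2 × Fin 2) ℂ) :
    Matrix (Fin 2 × Fin 2) (Fin 2 × Fin 2) ℂ :=
  (σy ⊗ₖ σy) * ρ.map star * (σy ⊗ₖ σy)

/-- The square roots of the eigenvalues (with multiplicity) of `ρ ρ̃`; for a density
matrix `ρ` these eigenvalues are real and nonnegative. -/
def flipSpectrum (ρ : Matrix (Fin 2 × Fin 2) (Fin 2 × Fin 2) ℂ) : Multiset ℝ :=
  (ρ * spinFlip ρ).charpoly.roots.map fun z => √z.re

/-- Wootters' concurrence `max (0, λ₁ - λ₂ - λ₃ - λ₄)`, where `λ₁ ≥ λ₂ ≥ λ₃ ≥ λ₄` are the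
square roots of the eigenvalues of `ρ ρ̃`; note `λ₁ - λ₂ - λ₃ - λ₄ = 2 λ₁ - ∑ λᵢ`. -/
def concurrence (ρ : Matrix (Fin 2 × Fin 2) (Fin 2 × Fin 2) ℂ) : ℝ :=
  max 0 (2 * (flipSpectrum ρ).fold max 0 - (flipSpectrum ρ).sum)

/-- The three-tangle (residual tangle) `C²_{A(BC)} - C²_{AB} - C²_{AC}` of a pure state of
three spins, where `C²_{A(BC)} = 4 det ρ_A`. -/
def threeTangle (ψ : State 3) : ℝ :=
  4 * (reducedA ψ).det.re - concurrence (reducedAB ψ) ^ 2 - concurrence (reducedAC ψ) ^ 2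

/-- The one-parameter family `cos θ |000⟩ + sin θ (|011⟩ + |101⟩ + |110⟩) / √3`. -/
def family (θ : ℝ) : Fin 4 → ℂ := ![(Real.cos θ : ℂ), 0, 0, (Real.sin θ : ℂ)]

end IsingChain

end

open IsingChain

namespace IsingChain

/-! The global spin flip exchanges `φ₀` with `φ₁` and `φ₂` with `φ₃`; on the symmetric sector its
eigenspaces are `V₁` (eigenvalue 1) and `V₂` (eigenvalue -1). It commutes with the Hamiltonian, and
`|000⟩` has components of equal norm in both. `pairVec e f` puts `e/√2` in `V₁` and `f/√2` in `V₂`,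
and `setO` is exactly the set of such vectors with `e` and `f` both of norm 1 (`mem_setO_iff`).

Upper bound (`reachableSet_subset`). If a permutation `τ` of the basis states commutes with the
Hamiltonian, then `Re ⟨ψ, ψ ∘ τ⟩` is constant along every Carathéodory solution, being absolutely
continuous with derivative zero almost everywhere. The identity, the permutations of the spins and
the global flip give conservation of the norm, of permutation symmetry and of the difference of the
weights in `V₁` and `V₂`. Hence both components keep their norms.

Lower bound (`ofDicke_mem_reachableSet`). In each sector the controls 0 and 1 generate a phase times
a rotation, written with unit quaternions. All these flows have period 2π, so negative times are
available and the reachable motions form a group in `(U(1) × SU(2))²`. It projects onto each `SU(2)`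
by Euler angles (`mem_of_tilted_axis`). The two sectors can be moved independently because some word
is central in one sector and far from central in the other (`exists_word`); its conjugates and their
products fill the whole `SU(2)` of the latter (`mem_of_normal_generation`). Since `SU(2)` is
transitive on unit vectors of `ℂ²`, all of `setO` is reached.

The tangle bound is `4 det ρ_A ≤ (tr ρ_A)²`; for the explicit family the matrix `ρ ρ̃` splits into
two singular 2×2 blocks, so the concurrences are elementary. -/

/-! ### Action of the Hamiltonian on amplitudes, and its Hermiticity -/

/-- A one-site operator acts on the bit at its site only. -/
theorem siteOp_mulVec {n : ℕ} (j : Fin n) (σ : Matrix (Fin 2) (Fin 2) ℂ) (ψ : State n)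
    (a : Fin n → Fin 2) :
    (siteOp j σ *ᵥ ψ) a = ∑ c, σ (a j) c * ψ (Function.update a j c) := by
  symm
  refine Finset.sum_of_injOn (fun c => Function.update a j c) ?_ (by simp) ?_ ?_
  · intro c _ d _ h
    simpa using congrFun h j
  · intro b _ hb
    have : ∃ k, k ≠ j ∧ b k ≠ a k := by
      by_contra! h
      refine hb ⟨b j, by simp, ?_⟩
      ext k
      by_cases hk : k = j
      · subst hk; simp
      · simp [hk, h k hk]
    obtain ⟨k, hk, hne⟩ := this
    have h0 : siteOp j σ a b = 0 :=
      Finset.prod_eq_zero (Finset.mem_univ k) (by simp [hk, Matrix.one_apply_ne' hne])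
    simp [h0]
  · intro c _
    have h1 : siteOp j σ a (Function.update a j c) = σ (a j) c := by
      unfold siteOp
      rw [Finset.prod_eq_single j (fun k _ hk => by simp [hk, Matrix.one_apply]) (by simp)]
      simp
    simp only [h1]

/-- The sign of a basis state of one spin under `σz`. -/
def sgn (b : Fin 2) : ℂ := if b = 0 then 1 else -1

theorem siteOp_σz_mulVec {n : ℕ} (j : Fin n) (ψ : State n) (a : Fin n → Fin 2) :
    (siteOp j σz *ᵥ ψ) a = sgn (a j) * ψ a := by
  have h : ∀ b, a j = b → Function.update a j b = a := by rintro _ rfl; simp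
  rw [siteOp_mulVec]
  generalize a j = b at h ⊢
  fin_cases b
  · simpa [σz, sgn] using congrArg ψ (h 0 rfl)
  · simpa [σz, sgn] using congrArg ψ (h 1 rfl)

theorem siteOp_σx_mulVec {n : ℕ} (j : Fin n) (ψ : State n) (a : Fin n → Fin 2) :
    (siteOp j σx *ᵥ ψ) a = ψ (a + Pi.single j 1) := by
  have h : a + Pi.single j 1 = Function.update a j (a j + 1) := by
    ext k
    by_cases hk : k = j
    · subst hk; simp
    · simp [hk]
  rw [siteOp_mulVec, h]
  generalize a j = b
  fin_cases b <;> simp [σx]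

theorem H₀_mulVec {n : ℕ} [NeZero n] (ψ : State n) (a : Fin n → Fin 2) :
    (H₀ n *ᵥ ψ) a = ∑ j, sgn (a j) * sgn (a (j + 1)) * ψ a := by
  simp [H₀, Matrix.sum_mulVec, ← Matrix.mulVec_mulVec, siteOp_σz_mulVec, mul_assoc]

theorem H₁_mulVec {n : ℕ} (ψ : State n) (a : Fin n → Fin 2) :
    (H₁ n *ᵥ ψ) a = ∑ j, ψ (a + Pi.single j 1) := by
  simp [H₁, Matrix.sum_mulVec, siteOp_σx_mulVec]

theorem hamiltonian_mulVec {n : ℕ} [NeZero n] (u : ℝ) (ψ : State n) :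
    hamiltonian n u *ᵥ ψ = ((1 - u : ℝ) : ℂ) • (H₀ n *ᵥ ψ) + (u : ℂ) • (H₁ n *ᵥ ψ) := by
  simp [hamiltonian, Matrix.add_mulVec, Matrix.smul_mulVec]

theorem siteOp_isHermitian {n : ℕ} (j : Fin n) {σ : Matrix (Fin 2) (Fin 2) ℂ}
    (h : σ.IsHermitian) : (siteOp j σ).IsHermitian := by
  ext a b
  simp only [Matrix.conjTranspose_apply, siteOp, star_prod]
  refine Finset.prod_congr rfl fun k _ => ?_
  split
  · exact h.apply _ _
  · exact Matrix.isHermitian_one.apply _ _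

theorem σz_isHermitian : σz.IsHermitian := by
  ext i j; fin_cases i <;> fin_cases j <;> simp [σz]

theorem σx_isHermitian : σx.IsHermitian := by
  ext i j; fin_cases i <;> fin_cases j <;> simp [σx]

theorem hamiltonian_isHermitian {n : ℕ} [NeZero n] (u : ℝ) : (hamiltonian n u).IsHermitian := by
  have hz (j : Fin n) := siteOp_isHermitian j σz_isHermitian
  have hx (j : Fin n) := siteOp_isHermitian j σx_isHermitian
  -- Both factors are diagonal, hence commute; this makes their product Hermitian.
  have hc (j k : Fin n) : siteOp k σz * siteOp j σz = siteOp j σz * siteOp k σz := by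
    refine Matrix.ext_of_mulVec_single fun a => ?_
    ext b
    simp only [← Matrix.mulVec_mulVec, siteOp_σz_mulVec]
    ring
  unfold hamiltonian
  refine Matrix.IsHermitian.add ?_ ?_
  · rw [Matrix.IsHermitian, Matrix.conjTranspose_smul, H₀, Matrix.conjTranspose_sum]
    simp only [Matrix.conjTranspose_mul, (hz _).eq, hc, Complex.star_def, Complex.conj_ofReal]
  · rw [Matrix.IsHermitian, Matrix.conjTranspose_smul, H₁, Matrix.conjTranspose_sum]
    simp only [(hx _).eq, Complex.star_def, Complex.conj_ofReal]

/-! ### Symmetries of the three-spin chain -/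

theorem forall_bitString {p : (Fin 3 → Fin 2) → Prop} :
    (∀ a, p a) ↔ ∀ a b c, p ![a, b, c] := by
  refine ⟨fun h a b c => h _, fun h x => ?_⟩
  convert h (x 0) (x 1) (x 2)
  ext i
  fin_cases i <;> rfl

/-- A relabelling of the basis states under which the dynamics of the chain is invariant. -/
def IsSymmetry (τ : Equiv.Perm (Fin 3 → Fin 2)) : Prop :=
  ∀ (u : ℝ) (ψ : State 3), hamiltonian 3 u *ᵥ (ψ ∘ τ) = (hamiltonian 3 u *ᵥ ψ) ∘ τ

theorem isSymmetry_refl : IsSymmetry (Equiv.refl _) := fun _ _ => rfl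

/-- Simultaneous flip of all spins. -/
theorem isSymmetry_flip : IsSymmetry (Equiv.addRight 1) := by
  intro u ψ
  ext a
  have h (j : Fin 3) : a + Pi.single j 1 + 1 = a + 1 + Pi.single j 1 := by abel
  have hs (b c : Fin 2) : sgn (b + 1) * sgn (c + 1) = sgn b * sgn c := by
    fin_cases b <;> fin_cases c <;> simp [sgn]
  simp [hamiltonian_mulVec, H₀_mulVec, H₁_mulVec, h, hs]

theorem isSymmetry_perm (π : Equiv.Perm (Fin 3)) :
    IsSymmetry (π.symm.arrowCongr (Equiv.refl (Fin 2))) := by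
  intro u ψ
  ext a
  have h (j : Fin 3) : (a + Pi.single j 1) ∘ π = a ∘ π + Pi.single (π.symm j) 1 := by
    ext k
    by_cases hk : k = π.symm j
    · subst hk; simp
    · have : π k ≠ j := fun h => hk (by simp [← h])
      simp [hk, this]
  -- On a closed chain of three sites every pair is adjacent, so any permutation preserves the
  -- coupling.
  have h0 : ∑ j, sgn (a (π j)) * sgn (a (π (j + 1))) = ∑ j, sgn (a j) * sgn (a (j + 1)) := by
    revert π
    simp only [Fin.sum_univ_three]
    intro π _
    have : ∀ π : Equiv.Perm (Fin 3), (π 0 = 0 ∧ π 1 = 1 ∧ π 2 = 2) ∨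
      (π 0 = 0 ∧ π 1 = 2 ∧ π 2 = 1) ∨ (π 0 = 1 ∧ π 1 = 0 ∧ π 2 = 2) ∨
      (π 0 = 1 ∧ π 1 = 2 ∧ π 2 = 0) ∨ (π 0 = 2 ∧ π 1 = 0 ∧ π 2 = 1) ∨
      (π 0 = 2 ∧ π 1 = 1 ∧ π 2 = 0) := by decide
    simp only [zero_add, Fin.reduceAdd]
    rcases this π with h | h | h | h | h | h <;> obtain ⟨h0, h1, h2⟩ := h <;>
      simp only [h0, h1, h2] <;> ring
  have h1 : ∑ j, ψ (a ∘ π + Pi.single (π.symm j) 1) = ∑ j, ψ (a ∘ π + Pi.single j 1) :=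
    Equiv.sum_comp π.symm fun j => ψ (a ∘ π + Pi.single j 1)
  have hτ (b : Fin 3 → Fin 2) :
      π.symm.arrowCongr (Equiv.refl (Fin 2)) b = b ∘ π := rfl
  simp only [hamiltonian_mulVec, H₀_mulVec, H₁_mulVec, Pi.add_apply, Pi.smul_apply,
    Function.comp_apply, hτ, ← Finset.sum_mul, h0, h, h1]

/-! ### Trajectories -/

theorem intervalIntegrable_hamiltonian_mulVec {n : ℕ} [NeZero n] {u : ℝ → ℝ} {ψ : ℝ → State n}
    {a b : ℝ} (hab : a ≤ b) (hu : IntervalIntegrable u volume a b)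
    (hψ : ContinuousOn ψ (Set.Icc a b)) :
    IntervalIntegrable (fun s => (-Complex.I) • (hamiltonian n (u s) *ᵥ ψ s)) volume a b := by
  have hc (M : Matrix (Fin n → Fin 2) (Fin n → Fin 2) ℂ) :
      ContinuousOn (fun s => M *ᵥ ψ s) (Set.uIcc a b) := by
    rw [Set.uIcc_of_le hab]
    exact (Continuous.matrix_mulVec continuous_const continuous_id).comp_continuousOn hψ
  have hR {v : ℝ → ℝ} (hv : IntervalIntegrable v volume a b)
      (M : Matrix (Fin n → Fin 2) (Fin n → Fin 2) ℂ) :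
      IntervalIntegrable (fun s => (v s : ℂ) • (M *ᵥ ψ s)) volume a b :=
    IntervalIntegrable.smul_continuousOn
      (f := fun s => (v s : ℂ)) ⟨hv.1.ofReal, hv.2.ofReal⟩ (hc M)
  simp only [hamiltonian_mulVec]
  exact ((hR (intervalIntegrable_const.sub hu) _).add (hR hu _)).smul (-Complex.I)

/-- Infinitesimal conservation law: `H` is Hermitian and commutes with `τ`, so the two terms are
`i⟨ψ, H(ψ ∘ τ)⟩` and its negative. -/
theorem re_dotProduct_symmetry_eq_zero {τ : Equiv.Perm (Fin 3 → Fin 2)} (hτ : IsSymmetry τ)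
    (u : ℝ) (ψ f : State 3) (hf : f = (-Complex.I) • (hamiltonian 3 u *ᵥ ψ)) :
    (star f ⬝ᵥ (ψ ∘ τ) + star ψ ⬝ᵥ (f ∘ τ)).re = 0 := by
  have h1 : f ∘ τ = (-Complex.I) • (hamiltonian 3 u *ᵥ (ψ ∘ τ)) := by
    rw [hτ, hf]; rfl
  have h2 : star f = Complex.I • (star ψ ᵥ* hamiltonian 3 u) := by
    rw [hf, star_smul, Matrix.star_mulVec, (hamiltonian_isHermitian u).eq]
    simp
  rw [h1, h2, smul_dotProduct, dotProduct_smul, Matrix.dotProduct_mulVec]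
  simp

/-- For a symmetry `τ` of the chain, the real part of `⟨ψ, ψ ∘ τ⟩` is conserved. -/
theorem IsTrajectory.re_dotProduct_symmetry {u : ℝ → ℝ} {T : ℝ} {ψ : ℝ → State 3}
    (h : IsTrajectory 3 u T ψ) (hT : 0 ≤ T) {τ : Equiv.Perm (Fin 3 → Fin 2)}
    (hτ : IsSymmetry τ) :
    (star (ψ T) ⬝ᵥ (ψ T ∘ τ)).re = (star (ψ 0) ⬝ᵥ (ψ 0 ∘ τ)).re := by
  set f : ℝ → State 3 := fun s => (-Complex.I) • (hamiltonian 3 (u s) *ᵥ ψ s) with hf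
  have hfi : IntervalIntegrable f volume 0 T :=
    intervalIntegrable_hamiltonian_mulVec hT h.integrable h.continuousOn
  have hre (a) : IntervalIntegrable (fun s => (f s a).re) volume 0 T :=
    ⟨(hfi.1.eval a).re, (hfi.2.eval a).re⟩
  have him (a) : IntervalIntegrable (fun s => (f s a).im) volume 0 T :=
    ⟨(hfi.1.eval a).im, (hfi.2.eval a).im⟩
  -- `X` and `Y` are the real and imaginary parts of the amplitudes as indefinite integrals. Unlike
  -- `ψ` they are controlled outside `[0, T]` too, so two-sided derivatives make sense.
  set X : (Fin 3 → Fin 2) → ℝ → ℝ := fun a t => (ψ 0 a).re + ∫ s in (0 : ℝ)..t, (f s a).re with hX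
  set Y : (Fin 3 → Fin 2) → ℝ → ℝ := fun a t => (ψ 0 a).im + ∫ s in (0 : ℝ)..t, (f s a).im with hY
  have hψ : ∀ t ∈ Set.Icc 0 T, ∀ a, (ψ t a).re = X a t ∧ (ψ t a).im = Y a t := by
    intro t ht a
    have hft : IntervalIntegrable f volume 0 t :=
      hfi.mono_set (by rw [Set.uIcc_of_le hT, Set.uIcc_of_le ht.1]
                       exact Set.Icc_subset_Icc_right ht.2)
    have hfa : IntervalIntegrable (fun s => f s a) volume 0 t :=
      ⟨hft.1.eval a, hft.2.eval a⟩
    have e : (∫ s in (0 : ℝ)..t, f s) a = ∫ s in (0 : ℝ)..t, f s a :=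
      ((ContinuousLinearMap.proj (R := ℂ) (φ := fun _ : Fin 3 → Fin 2 => ℂ)
        a).intervalIntegral_comp_comm hft).symm
    have er := Complex.reCLM.intervalIntegral_comp_comm hfa
    have ei := Complex.imCLM.intervalIntegral_comp_comm hfa
    simp only [Complex.reCLM_apply, Complex.imCLM_apply] at er ei
    rw [h.eq_integral t ht, Pi.add_apply, e, Complex.add_re, Complex.add_im, ← er, ← ei]
    exact ⟨rfl, rfl⟩
  have hac {c : ℝ} {g : ℝ → ℝ} (hg : IntervalIntegrable g volume 0 T) :
      AbsolutelyContinuousOnInterval (fun t => c + ∫ s in (0 : ℝ)..t, g s) 0 T :=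
    ((LipschitzWith.const c).lipschitzOnWith.absolutelyContinuousOnInterval).add
      (hg.absolutelyContinuousOnInterval_intervalIntegral (by simp))
  have hsum {F : (Fin 3 → Fin 2) → ℝ → ℝ}
      (hF : ∀ a, AbsolutelyContinuousOnInterval (F a) 0 T) :
      AbsolutelyContinuousOnInterval (fun t => ∑ a, F a t) 0 T := by
    have : ∀ S : Finset (Fin 3 → Fin 2),
        AbsolutelyContinuousOnInterval (fun t => ∑ a ∈ S, F a t) 0 T := by
      intro S
      induction S using Finset.induction_on with
      | empty =>
        simpa using (LipschitzWith.const (0 : ℝ)).lipschitzOnWith.absolutelyContinuousOnInterval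
      | insert a S ha ih => simpa [Finset.sum_insert ha] using (hF a).fun_add ih
    exact this _
  set c : ℝ → ℝ := fun t => ∑ a, (X a t * X (τ a) t + Y a t * Y (τ a) t) with hc
  have hcac : AbsolutelyContinuousOnInterval c 0 T :=
    hsum fun a => ((hac (hre a)).fun_mul (hac (hre (τ a)))).fun_add
      ((hac (him a)).fun_mul (hac (him (τ a))))
  have hcψ : ∀ t ∈ Set.Icc 0 T, (star (ψ t) ⬝ᵥ (ψ t ∘ τ)).re = c t := by
    intro t ht
    simp [dotProduct, hc, hψ t ht]
  have hder : ∀ᵐ t, t ∈ Set.uIcc 0 T → HasDerivAt c 0 t := by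
    have h1 : ∀ᵐ t, ∀ a, t ∈ Set.uIcc 0 T → HasDerivAt (X a) (f t a).re t := by
      refine ae_all_iff.2 fun a => ?_
      filter_upwards [(hre a).ae_hasDerivAt_integral] with t ht h
      exact (ht h 0 (by simp)).const_add _
    have h2 : ∀ᵐ t, ∀ a, t ∈ Set.uIcc 0 T → HasDerivAt (Y a) (f t a).im t := by
      refine ae_all_iff.2 fun a => ?_
      filter_upwards [(him a).ae_hasDerivAt_integral] with t ht h
      exact (ht h 0 (by simp)).const_add _
    filter_upwards [h1, h2] with t h1 h2 ht
    have ht' : t ∈ Set.Icc 0 T := by rwa [Set.uIcc_of_le hT] at ht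
    have key := HasDerivAt.fun_sum fun a (_ : a ∈ Finset.univ) =>
      (((h1 a ht).mul (h1 (τ a) ht)).add ((h2 a ht).mul (h2 (τ a) ht)))
    refine key.congr_deriv ?_
    rw [← re_dotProduct_symmetry_eq_zero hτ (u t) (ψ t) (f t) rfl]
    simp only [dotProduct, Complex.add_re, Complex.re_sum, Function.comp_apply, Pi.star_apply,
      Complex.star_def, Complex.mul_re, Complex.conj_re, Complex.conj_im, hψ t ht',
      ← Finset.sum_add_distrib]
    exact Finset.sum_congr rfl fun a _ => by ring
  obtain ⟨C, hC⟩ := hcac.const_of_ae_hasDerivAt_zero hder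
  rw [hcψ T ⟨hT, le_rfl⟩, hcψ 0 ⟨le_rfl, hT⟩, hC T (by simp), hC 0 (by simp)]

/-! ### Bang-bang controls and concatenation of trajectories -/

/-- The piecewise constant controls with values in `{0, 1}`. -/
def bangBang : Set (ℝ → ℝ) := {u | IsPiecewiseConstant u ∧ ∀ t, u t = 0 ∨ u t = 1}

theorem reachableSet_mono {n : ℕ} [NeZero n] {𝒰 𝒱 : Set (ℝ → ℝ)} (h : 𝒰 ⊆ 𝒱) (ψ₀ : State n) :
    reachableSet n 𝒰 ψ₀ ⊆ reachableSet n 𝒱 ψ₀ :=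
  fun _ ⟨u, hu, H⟩ => ⟨u, h hu, H⟩

theorem self_mem_reachableSet {n : ℕ} [NeZero n] (ψ₀ : State n) :
    ψ₀ ∈ reachableSet n bangBang ψ₀ :=
  ⟨fun _ => 0, ⟨⟨∅, fun _ _ _ _ => rfl⟩, fun _ => Or.inl rfl⟩, 0, le_rfl, fun _ => ψ₀,
    ⟨by simp, continuousOn_const, fun t ht => by simp [le_antisymm ht.2 ht.1]⟩, rfl, rfl⟩

/-- A trajectory can be continued with a constant control. -/
theorem reachableSet_bangBang_extend {n : ℕ} [NeZero n] {ψ₀ χ : State n}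
    (hχ : χ ∈ reachableSet n bangBang ψ₀) {b : ℝ} (hb : b = 0 ∨ b = 1) {φ : ℝ → State n}
    (hφ : ∀ s, HasDerivAt φ ((-Complex.I) • (hamiltonian n b *ᵥ φ s)) s) (hφ0 : φ 0 = χ)
    {t : ℝ} (ht : 0 ≤ t) : φ t ∈ reachableSet n bangBang ψ₀ := by
  obtain ⟨u, ⟨⟨F, hF⟩, hu⟩, T, hT, ψ, hψ, h0, hψT⟩ := hχ
  -- The control takes the new value already at `T`; the two pieces of the state agree there.
  set v : ℝ → ℝ := fun s => if s < T then u s else b with hv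
  set ψ' : ℝ → State n := fun s => if s ≤ T then ψ s else φ (s - T) with hψ'
  have hle {s : ℝ} (hs : s ≤ T) : ψ' s = ψ s := by simp [hψ', hs]
  have hge {s : ℝ} (hs : T ≤ s) : ψ' s = φ (s - T) := by
    rcases hs.eq_or_lt with rfl | hs
    · simp [hψ', hφ0, hψT]
    · simp [hψ', hs.not_ge]
  have hvlt : Set.EqOn u v (Set.Ioo 0 T) := fun s hs => by simp [hv, hs.2]
  have hvge {s : ℝ} (hs : T ≤ s) : v s = b := by simp [hv, hs.not_gt]
  have hφc : Continuous φ := continuous_iff_continuousAt.2 fun s => (hφ s).continuousAt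
  set f : ℝ → State n := fun s => (-Complex.I) • (hamiltonian n (v s) *ᵥ ψ' s) with hf
  have hv1 : IntervalIntegrable v volume 0 T := by
    refine hψ.integrable.congr_uIoo ?_
    rwa [Set.uIoo_of_le hT]
  have hv2 : IntervalIntegrable v volume T (T + t) := by
    refine (intervalIntegrable_const (c := b)).congr fun s hs => ?_
    rw [Set.uIoc_of_le (by linarith)] at hs
    exact (hvge hs.1.le).symm
  have hc1 : ContinuousOn ψ' (Set.Icc 0 T) :=
    hψ.continuousOn.congr fun s hs => hle hs.2
  have hc2 : ContinuousOn ψ' (Set.Icc T (T + t)) :=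
    (hφc.comp (continuous_sub_right T)).continuousOn.congr fun s hs => hge hs.1
  have hc : ContinuousOn ψ' (Set.Icc 0 (T + t)) := by
    rw [← Set.Icc_union_Icc_eq_Icc hT (by linarith : T ≤ T + t)]
    exact hc1.union_of_isClosed hc2 isClosed_Icc isClosed_Icc
  have hfint : ∀ s ∈ Set.Icc 0 T, ∫ r in (0 : ℝ)..s, f r =
      ∫ r in (0 : ℝ)..s, (-Complex.I) • (hamiltonian n (u r) *ᵥ ψ r) := by
    intro s hs
    refine intervalIntegral.integral_congr_Ioo_of_le hs.1 fun r hr => ?_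
    have hrT : r < T := hr.2.trans_le hs.2
    simp only [hf, hle hrT.le, hvlt ⟨hr.1, hrT⟩]
  have hfT : ∀ s, T ≤ s → IntervalIntegrable f volume T s →
      ∫ r in T..s, f r = φ (s - T) - φ 0 := by
    intro s hs hi
    rw [intervalIntegral.integral_eq_sub_of_hasDerivAt (f := fun r => φ (r - T)) _ hi, sub_self]
    intro r hr
    rw [Set.uIcc_of_le hs] at hr
    simpa [hf, hge hr.1, hvge hr.1] using (hφ (r - T)).comp_sub_const r T
  refine ⟨v, ⟨⟨insert T F, ?_⟩, ?_⟩, T + t, by linarith, ψ',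
    ⟨hv1.trans hv2, hc, ?_⟩, by rw [hle hT, h0], by rw [hge (by linarith)]; simp⟩
  -- A closed interval that avoids the new switching time `T` lies on one side of it.
  · intro r s hrs hd
    rw [Finset.coe_insert, Set.disjoint_insert_right] at hd
    rcases lt_or_ge s T with hs | hs
    · simpa [hv, hs, hrs.trans_lt hs] using hF r s hrs hd.2
    · have hr : T ≤ r := by
        by_contra! h
        exact hd.1 ⟨h.le, hs⟩
      rw [hvge hr, hvge hs]
  · intro s
    by_cases hs : s < T
    · simpa [hv, hs] using hu s
    · simpa [hv, hs] using hb
  · intro s hs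
    rw [hle hT]
    rcases le_total s T with hsT | hsT
    · rw [hle hsT, hψ.eq_integral s ⟨hs.1, hsT⟩, ← hfint s ⟨hs.1, hsT⟩]
    · have i1 := intervalIntegrable_hamiltonian_mulVec hT hv1 hc1
      have i2 : IntervalIntegrable f volume T s :=
        intervalIntegrable_hamiltonian_mulVec hsT
          (hv2.mono_set (Set.uIcc_subset_uIcc_left (by rw [Set.mem_uIcc]; exact .inl ⟨hsT, hs.2⟩)))
          (hc2.mono (Set.Icc_subset_Icc_right hs.2))
      rw [hge hsT, ← intervalIntegral.integral_add_adjacent_intervals i1 i2,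
        hfT s hsT i2, hfint T ⟨hT, le_rfl⟩, ← add_assoc, ← hψ.eq_integral T ⟨hT, le_rfl⟩,
        hφ0, hψT]
      simp

/-! ### Coordinates in the symmetric sector -/

theorem ofDicke_apply (v : Fin 4 → ℂ) :
    (ofDicke v ![0, 0, 0] = v 0 ∧ ofDicke v ![1, 1, 1] = v 1) ∧
    (ofDicke v ![1, 0, 0] = v 2 * (1 / √3 : ℝ) ∧ ofDicke v ![0, 1, 0] = v 2 * (1 / √3 : ℝ) ∧
      ofDicke v ![0, 0, 1] = v 2 * (1 / √3 : ℝ)) ∧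
    (ofDicke v ![0, 1, 1] = v 3 * (1 / √3 : ℝ) ∧ ofDicke v ![1, 0, 1] = v 3 * (1 / √3 : ℝ) ∧
      ofDicke v ![1, 1, 0] = v 3 * (1 / √3 : ℝ)) := by
  simp [ofDicke, dicke, ket, Fin.sum_univ_four]

/-- The coordinates of a symmetric state. -/
noncomputable def dickeCoord (ψ : State 3) : Fin 4 → ℂ :=
  ![ψ ![0, 0, 0], ψ ![1, 1, 1], (√3 : ℝ) * ψ ![1, 0, 0], (√3 : ℝ) * ψ ![0, 1, 1]]

theorem dickeCoord_ofDicke (v : Fin 4 → ℂ) : dickeCoord (ofDicke v) = v := by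
  have h3 : ((√3 : ℝ) : ℂ) ≠ 0 := by simp
  obtain ⟨⟨h0, h1⟩, ⟨h2, -, -⟩, ⟨h3, -, -⟩⟩ := ofDicke_apply v
  ext i
  fin_cases i <;> simp [dickeCoord, h0, h1, h2, h3] <;> field_simp

theorem ofDicke_injective : Function.Injective ofDicke :=
  Function.LeftInverse.injective dickeCoord_ofDicke

/-- `ofDicke` as a linear map. -/
noncomputable def ofDickeₗ : (Fin 4 → ℂ) →ₗ[ℂ] State 3 where
  toFun := ofDicke
  map_add' v w := by simp [ofDicke, add_smul, Finset.sum_add_distrib]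
  map_smul' c v := by simp [ofDicke, mul_smul, Finset.smul_sum]

theorem ofDickeₗ_apply (v : Fin 4 → ℂ) : ofDickeₗ v = ofDicke v := rfl

/-- The orbits of the permutations on bit strings are the classes of equal weight; those of weight 0
and 3 are singletons and impose nothing. -/
theorem mem_symmetricSector_iff (ψ : State 3) : ψ ∈ symmetricSector ↔
    (ψ ![0, 1, 0] = ψ ![1, 0, 0] ∧ ψ ![0, 0, 1] = ψ ![1, 0, 0]) ∧
    (ψ ![1, 0, 1] = ψ ![0, 1, 1] ∧ ψ ![1, 1, 0] = ψ ![0, 1, 1]) := by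
  have hs (π : Equiv.Perm (Fin 3)) (a b c : Fin 2) :
      ![a, b, c] ∘ π = ![![a, b, c] (π 0), ![a, b, c] (π 1), ![a, b, c] (π 2)] := by
    ext i; fin_cases i <;> rfl
  constructor
  · intro h
    have h1 := h (Equiv.swap 0 1)
    have h2 := h (Equiv.swap 0 2)
    simp only [forall_bitString, hs] at h1 h2
    have e1 : Equiv.swap (0 : Fin 3) 1 2 = 2 := by decide
    have e2 : Equiv.swap (0 : Fin 3) 2 1 = 1 := by decide
    exact ⟨⟨by simpa [e1] using h1 1 0 0, by simpa [e2] using h2 1 0 0⟩,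
      ⟨by simpa [e1] using h1 0 1 1, by simpa [e2] using h2 0 1 1⟩⟩
  · rintro ⟨⟨h1, h2⟩, ⟨h3, h4⟩⟩ π
    rw [forall_bitString]
    intro a b c
    rw [hs]
    have : ∀ π : Equiv.Perm (Fin 3), (π 0 = 0 ∧ π 1 = 1 ∧ π 2 = 2) ∨
      (π 0 = 0 ∧ π 1 = 2 ∧ π 2 = 1) ∨ (π 0 = 1 ∧ π 1 = 0 ∧ π 2 = 2) ∨
      (π 0 = 1 ∧ π 1 = 2 ∧ π 2 = 0) ∨ (π 0 = 2 ∧ π 1 = 0 ∧ π 2 = 1) ∨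
      (π 0 = 2 ∧ π 1 = 1 ∧ π 2 = 0) := by decide
    rcases this π with h | h | h | h | h | h <;> obtain ⟨p0, p1, p2⟩ := h <;>
      rw [p0, p1, p2] <;> fin_cases a <;> fin_cases b <;> fin_cases c <;> simp [h1, h2, h3, h4]

theorem ofDicke_mem_symmetricSector (v : Fin 4 → ℂ) : ofDicke v ∈ symmetricSector := by
  obtain ⟨-, ⟨h1, h2, h3⟩, ⟨h4, h5, h6⟩⟩ := ofDicke_apply v
  simp [mem_symmetricSector_iff, *]

theorem ofDicke_dickeCoord {ψ : State 3} (h : ψ ∈ symmetricSector) :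
    ofDicke (dickeCoord ψ) = ψ := by
  have h3 : ((√3 : ℝ) : ℂ) ≠ 0 := by simp
  obtain ⟨⟨h0, h1⟩, ⟨h2, h3, h4⟩, ⟨h5, h6, h7⟩⟩ := ofDicke_apply (dickeCoord ψ)
  obtain ⟨⟨s1, s2⟩, ⟨s3, s4⟩⟩ := (mem_symmetricSector_iff ψ).1 h
  have : ∀ a, ofDicke (dickeCoord ψ) a = ψ a := by
    rw [forall_bitString]
    intro a b c
    fin_cases a <;> fin_cases b <;> fin_cases c <;>
      simp only [Fin.zero_eta, Fin.mk_one, Fin.isValue, h0, h1, h2, h3, h4, h5, h6, h7, s1, s2,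
        s3, s4] <;> simp [dickeCoord] <;> field_simp
  exact funext this

theorem range_ofDickeₗ : LinearMap.range ofDickeₗ = symmetricSector := by
  ext ψ
  constructor
  · rintro ⟨v, rfl⟩
    exact ofDicke_mem_symmetricSector v
  · exact fun h => ⟨_, ofDicke_dickeCoord h⟩

theorem symmetricSector_eq_span : symmetricSector = Submodule.span ℂ (Set.range dicke) := by
  ext ψ
  rw [← range_ofDickeₗ, Submodule.mem_span_range_iff_exists_fun]
  rfl

theorem sum_bitString {M : Type*} [AddCommMonoid M] (f : (Fin 3 → Fin 2) → M) :
    ∑ a, f a = f ![0, 0, 0] + f ![1, 1, 1] + (f ![1, 0, 0] + f ![0, 1, 0] + f ![0, 0, 1]) +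
      (f ![0, 1, 1] + f ![1, 0, 1] + f ![1, 1, 0]) := by
  have : (Finset.univ : Finset (Fin 3 → Fin 2)) = {![0, 0, 0], ![1, 1, 1], ![1, 0, 0],
      ![0, 1, 0], ![0, 0, 1], ![0, 1, 1], ![1, 0, 1], ![1, 1, 0]} := by decide
  rw [this]
  repeat rw [Finset.sum_insert (by decide)]
  rw [Finset.sum_singleton]
  simp only [add_assoc]

theorem sum_norm_ofDicke (v : Fin 4 → ℂ) : ∑ a, ‖ofDicke v a‖ ^ 2 = ∑ i, ‖v i‖ ^ 2 := by
  obtain ⟨⟨h0, h1⟩, ⟨h2, h3, h4⟩, ⟨h5, h6, h7⟩⟩ := ofDicke_apply v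
  simp only [sum_bitString, h0, h1, h2, h3, h4, h5, h6, h7, Fin.sum_univ_four, norm_mul,
    Complex.norm_real, mul_pow, Real.norm_eq_abs, sq_abs, div_pow]
  rw [Real.sq_sqrt (by norm_num)]
  ring

theorem isUnitVector_ofDicke (v : Fin 4 → ℂ) : IsUnitVector (ofDicke v) ↔ IsUnitVector v := by
  rw [IsUnitVector, sum_norm_ofDicke, IsUnitVector]

/-- The Hamiltonian in Dicke coordinates. -/
theorem hamiltonian_mulVec_ofDicke (u : ℝ) (v : Fin 4 → ℂ) :
    hamiltonian 3 u *ᵥ ofDicke v =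
      ofDicke (((1 - u : ℝ) : ℂ) • ![3 * v 0, 3 * v 1, -v 2, -v 3] +
        (u : ℂ) • ![(√3 : ℝ) * v 2, (√3 : ℝ) * v 3, (√3 : ℝ) * v 0 + 2 * v 3,
          (√3 : ℝ) * v 1 + 2 * v 2]) := by
  have h3 : ((√3 : ℝ) : ℂ) ≠ 0 := by simp
  have h3' : ((√3 : ℝ) : ℂ) ^ 2 = 3 := by
    rw [← Complex.ofReal_pow, Real.sq_sqrt (by norm_num)]; norm_num
  obtain ⟨⟨h0, h1⟩, ⟨h2, h3, h4⟩, ⟨h5, h6, h7⟩⟩ := ofDicke_apply v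
  set w := ((1 - u : ℝ) : ℂ) • ![3 * v 0, 3 * v 1, -v 2, -v 3] +
        (u : ℂ) • ![(√3 : ℝ) * v 2, (√3 : ℝ) * v 3, (√3 : ℝ) * v 0 + 2 * v 3,
          (√3 : ℝ) * v 1 + 2 * v 2] with hw
  obtain ⟨⟨w0, w1⟩, ⟨w2, w3, w4⟩, ⟨w5, w6, w7⟩⟩ := ofDicke_apply w
  have : ∀ a, (hamiltonian 3 u *ᵥ ofDicke v) a = ofDicke w a := by
    rw [forall_bitString]
    intro a b c
    have e0 : ![a, b, c] + Pi.single 0 1 = ![a + 1, b, c] := by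
      ext i; fin_cases i <;> simp
    have e1 : ![a, b, c] + Pi.single 1 1 = ![a, b + 1, c] := by
      ext i; fin_cases i <;> simp
    have e2 : ![a, b, c] + Pi.single 2 1 = ![a, b, c + 1] := by
      ext i; fin_cases i <;> simp
    simp only [hamiltonian_mulVec, Pi.add_apply, Pi.smul_apply, H₀_mulVec, H₁_mulVec,
      Fin.sum_univ_three, e0, e1, e2]
    clear e0 e1 e2
    fin_cases a <;> fin_cases b <;> fin_cases c <;>
      simp [sgn, h0, h1, h2, h3, h4, h5, h6, h7, w0, w1, w2, w3, w4, w5, w6, w7] <;>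
      simp [hw] <;> field_simp <;>
      first
        | ring1
        | linear_combination (-(u * v 2)) * h3'
        | linear_combination (-(u * v 3)) * h3'
  exact funext this

/-! ### The two invariant subspaces -/

/-- The vector `(e ⊗ f₊ + f ⊗ f₋) / √2`. -/
noncomputable def pairVec (e f : Fin 2 → ℂ) : Fin 4 → ℂ :=
  ((1 / √2 : ℝ) : ℂ) • tensor e fPlus + ((1 / √2 : ℝ) : ℂ) • tensor f fMinus

theorem pairVec_eq (e f : Fin 2 → ℂ) :
    pairVec e f = ![(e 0 + f 0) / 2, (e 0 - f 0) / 2, (e 1 + f 1) / 2, (e 1 - f 1) / 2] := by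
  have h : ((√2 : ℝ) : ℂ)⁻¹ * ((√2 : ℝ) : ℂ)⁻¹ = 1 / 2 := by
    rw [← mul_inv, ← Complex.ofReal_mul, Real.mul_self_sqrt (by norm_num)]; norm_num
  ext i
  fin_cases i <;> simp [pairVec, tensor, fPlus, fMinus]
  · linear_combination (e 0 + f 0) * h
  · linear_combination (e 0 - f 0) * h
  · linear_combination (e 1 + f 1) * h
  · linear_combination (e 1 - f 1) * h

theorem exists_pairVec (v : Fin 4 → ℂ) : ∃ e f, v = pairVec e f := by
  refine ⟨![v 0 + v 1, v 2 + v 3], ![v 0 - v 1, v 2 - v 3], ?_⟩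
  rw [pairVec_eq]
  ext i
  fin_cases i <;> simp

theorem pairVec_injective {e f e' f' : Fin 2 → ℂ} (h : pairVec e f = pairVec e' f') :
    e = e' ∧ f = f' := by
  rw [pairVec_eq, pairVec_eq] at h
  have h0 := congrFun h 0
  have h1 := congrFun h 1
  have h2 := congrFun h 2
  have h3 := congrFun h 3
  simp at h0 h1 h2 h3
  constructor
  · ext i
    fin_cases i
    · simp; linear_combination (h0 + h1) / 2
    · simp; linear_combination (h2 + h3) / 2
  · ext i
    fin_cases i
    · simp; linear_combination (h0 - h1) / 2
    · simp; linear_combination (h2 - h3) / 2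

theorem sqrt_two_mul_inv : ((1 / √2 : ℝ) : ℂ) * ((√2 : ℝ) : ℂ) = 1 := by
  rw [← Complex.ofReal_mul]; simp

theorem smul_tensor (c : ℂ) (e f : Fin 2 → ℂ) : c • tensor e f = tensor (c • e) f := by
  ext i; fin_cases i <;> simp [tensor, mul_assoc]

theorem smul_tensor_add_smul_tensor (c d : ℂ) (e f : Fin 2 → ℂ) :
    c • tensor e fPlus + d • tensor f fMinus =
      pairVec ((c * (√2 : ℝ)) • e) ((d * (√2 : ℝ)) • f) := by
  simp only [pairVec, smul_tensor, smul_smul]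
  rw [mul_comm c, mul_comm d, ← mul_assoc, ← mul_assoc, sqrt_two_mul_inv, one_mul, one_mul]

theorem isUnitVector_smul_iff {e : Fin 2 → ℂ} (he : IsUnitVector e) (c : ℂ) :
    IsUnitVector (c • e) ↔ ‖c‖ = 1 := by
  have : ∑ i, ‖(c • e) i‖ ^ 2 = ‖c‖ ^ 2 := by
    simp only [Pi.smul_apply, smul_eq_mul, norm_mul, mul_pow, ← Finset.mul_sum]
    rw [he, mul_one]
  rw [IsUnitVector, this, pow_eq_one_iff_of_nonneg (norm_nonneg c) two_ne_zero]

theorem norm_phase (x : ℝ) : ‖phase x‖ = 1 := by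
  rw [phase, mul_comm]; exact Complex.norm_exp_ofReal_mul_I x

theorem exists_phase (z : ℂ) : ∃ x : ℝ, z = phase x * (‖z‖ : ℂ) := by
  refine ⟨z.arg, ?_⟩
  rw [phase, mul_comm Complex.I, mul_comm]
  exact (Complex.norm_mul_exp_arg_mul_I z).symm

theorem isUnitVector_phase (μ φ ζ θ : ℝ) :
    IsUnitVector ![phase μ * (phase φ * Real.cos θ), phase μ * (phase ζ * Real.sin θ)] := by
  simp only [IsUnitVector, Fin.sum_univ_two, Matrix.cons_val_zero, Matrix.cons_val_one,
    norm_mul, norm_phase, Complex.norm_real, one_mul, Real.norm_eq_abs, sq_abs]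
  exact Real.cos_sq_add_sin_sq θ

theorem exists_phase_of_isUnitVector {e : Fin 2 → ℂ} (h : IsUnitVector e) :
    ∃ φ ζ θ : ℝ, e = ![phase φ * Real.cos θ, phase ζ * Real.sin θ] := by
  obtain ⟨φ, hφ⟩ := exists_phase (e 0)
  obtain ⟨ζ, hζ⟩ := exists_phase (e 1)
  rw [IsUnitVector, Fin.sum_univ_two] at h
  refine ⟨φ, ζ, Real.arccos ‖e 0‖, ?_⟩
  have hc : Real.cos (Real.arccos ‖e 0‖) = ‖e 0‖ :=
    Real.cos_arccos (by linarith [norm_nonneg (e 0)]) (by nlinarith [sq_nonneg ‖e 1‖])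
  have hs : Real.sin (Real.arccos ‖e 0‖) = ‖e 1‖ := by
    rw [Real.sin_arccos, ← h, add_sub_cancel_left, Real.sqrt_sq (norm_nonneg _)]
  ext i
  fin_cases i
  · simpa [hc] using hφ
  · simpa [hs] using hζ

/-- Unit vectors of `ℂ²` are the `(e^{iφ} cos θ, e^{iζ} sin θ)`. The phases `e^{±iμ}` are absorbed
into the other phases, so `μ = 0` suffices. -/
theorem mem_setO_iff (v : Fin 4 → ℂ) :
    v ∈ setO ↔ ∃ e f : Fin 2 → ℂ, IsUnitVector e ∧ IsUnitVector f ∧ v = pairVec e f := by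
  constructor
  · rintro ⟨φ, ζ, θ, α, β, γ, μ, rfl⟩
    refine ⟨_, _, isUnitVector_phase μ φ ζ θ, isUnitVector_phase (-μ) α β γ, ?_⟩
    rw [pairVec_eq]
    ext i
    fin_cases i <;> simp <;> ring
  · rintro ⟨e, f, he, hf, rfl⟩
    obtain ⟨φ, ζ, θ, rfl⟩ := exists_phase_of_isUnitVector he
    obtain ⟨α, β, γ, rfl⟩ := exists_phase_of_isUnitVector hf
    refine ⟨φ, ζ, θ, α, β, γ, 0, ?_⟩
    rw [pairVec_eq]
    ext i
    fin_cases i <;> simp [phase] <;> ring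

theorem pairVec_mem_setO_iff {e f : Fin 2 → ℂ} :
    pairVec e f ∈ setO ↔ IsUnitVector e ∧ IsUnitVector f := by
  rw [mem_setO_iff]
  constructor
  · rintro ⟨e', f', he, hf, h⟩
    obtain ⟨rfl, rfl⟩ := pairVec_injective h
    exact ⟨he, hf⟩
  · rintro ⟨he, hf⟩
    exact ⟨e, f, he, hf, rfl⟩

theorem eq_inv_sqrt_two_of_mem_setO {e f : Fin 2 → ℂ} {r s : ℝ} (he : IsUnitVector e)
    (hf : IsUnitVector f) (hr : 0 ≤ r) (hs : 0 ≤ s)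
    (h : (r : ℂ) • tensor e fPlus + (s : ℂ) • tensor f fMinus ∈ setO) :
    r = s ∧ r = 1 / √2 := by
  rw [smul_tensor_add_smul_tensor, pairVec_mem_setO_iff, isUnitVector_smul_iff he,
    isUnitVector_smul_iff hf] at h
  have key {x : ℝ} (hx : 0 ≤ x) (h : ‖(x : ℂ) * (√2 : ℝ)‖ = 1) : x = 1 / √2 := by
    rw [← Complex.ofReal_mul, Complex.norm_real, Real.norm_of_nonneg (by positivity)] at h
    exact eq_one_div_of_mul_eq_one_left h
  rw [key hr h.1, key hs h.2]
  exact ⟨rfl, rfl⟩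

theorem sum_norm_pairVec (e f : Fin 2 → ℂ) :
    ∑ i, ‖pairVec e f i‖ ^ 2 = (∑ i, ‖e i‖ ^ 2 + ∑ i, ‖f i‖ ^ 2) / 2 := by
  rw [pairVec_eq]
  simp only [Fin.sum_univ_four, Fin.sum_univ_two, Matrix.cons_val, ← Complex.normSq_eq_norm_sq,
    Complex.normSq_apply, Complex.div_ofNat_re, Complex.div_ofNat_im, Complex.add_re,
    Complex.add_im, Complex.sub_re, Complex.sub_im]
  ring

theorem isUnitVector_of_mem_setO {v : Fin 4 → ℂ} (h : v ∈ setO) : IsUnitVector v := by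
  obtain ⟨e, f, he, hf, rfl⟩ := (mem_setO_iff v).1 h
  rw [IsUnitVector, sum_norm_pairVec, he, hf]
  norm_num

/-- The overlap of a symmetric state with its global spin flip. -/
theorem re_dotProduct_flip (e f : Fin 2 → ℂ) :
    (star (ofDicke (pairVec e f)) ⬝ᵥ (ofDicke (pairVec e f) ∘ Equiv.addRight 1)).re =
      (∑ i, ‖e i‖ ^ 2 - ∑ i, ‖f i‖ ^ 2) / 2 := by
  have hf (a b c : Fin 2) : ![a, b, c] + 1 = ![a + 1, b + 1, c + 1] := by
    ext i; fin_cases i <;> simp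
  obtain ⟨⟨h0, h1⟩, ⟨h2, h3, h4⟩, ⟨h5, h6, h7⟩⟩ := ofDicke_apply (pairVec e f)
  simp only [dotProduct, sum_bitString, Function.comp_apply, Equiv.coe_addRight, hf, Pi.star_apply,
    Fin.isValue, zero_add, Fin.reduceAdd, h0, h1, h2, h3, h4, h5, h6, h7]
  rw [pairVec_eq]
  simp only [Fin.sum_univ_two, Matrix.cons_val, ← Complex.normSq_eq_norm_sq, Complex.star_def,
    Complex.normSq_apply, Complex.div_ofNat_re, Complex.div_ofNat_im, Complex.add_re,
    Complex.add_im, Complex.sub_re, Complex.sub_im, Complex.mul_re, Complex.mul_im,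
    Complex.ofReal_re, Complex.ofReal_im, Complex.conj_re, Complex.conj_im]
  field_simp
  rw [Real.sq_sqrt (by norm_num)]
  ring

/-- The action of the Hamiltonian at control value `u` on the invariant subspaces: `κ = 1` on `V₁`
and `κ = -1` on `V₂`. -/
noncomputable def sectorAction (κ u : ℝ) (e : Fin 2 → ℂ) : Fin 2 → ℂ :=
  ![(1 - u) * (3 * e 0) + u * ((√3 : ℝ) * e 1),
    (1 - u) * (-e 1) + u * ((√3 : ℝ) * e 0 + 2 * κ * e 1)]

theorem hamiltonian_mulVec_pairVec (u : ℝ) (e f : Fin 2 → ℂ) :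
    hamiltonian 3 u *ᵥ ofDicke (pairVec e f) =
      ofDicke (pairVec (sectorAction 1 u e) (sectorAction (-1) u f)) := by
  rw [hamiltonian_mulVec_ofDicke, pairVec_eq, pairVec_eq]
  congr 1
  ext i
  fin_cases i <;> simp [sectorAction] <;> ring

theorem mem_sectorSubspace {f : Fin 2 → ℂ} {ψ : State 3} :
    ψ ∈ sectorSubspace f ↔ ∃ e, ψ = ofDicke (tensor e f) := by
  let g : (Fin 2 → ℂ) →ₗ[ℂ] State 3 := ofDickeₗ ∘ₗ
    { toFun := fun e => tensor e f
      map_add' := fun x y => by ext i; fin_cases i <;> simp [tensor, add_mul]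
      map_smul' := fun c x => (smul_tensor c x f).symm }
  have : sectorSubspace f = LinearMap.range g := by
    rw [← Submodule.span_eq (LinearMap.range g)]; rfl
  rw [this]
  exact ⟨fun ⟨e, h⟩ => ⟨e, h.symm⟩, fun ⟨e, h⟩ => ⟨e, h.symm⟩⟩

theorem mem_V₁ {ψ : State 3} : ψ ∈ V₁ ↔ ∃ e, ψ = ofDicke (pairVec e 0) := by
  rw [V₁, mem_sectorSubspace]
  have h (e) := smul_tensor_add_smul_tensor 1 0 e 0
  simp only [one_smul, zero_smul, add_zero, zero_mul] at h
  constructor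
  · rintro ⟨e, rfl⟩
    exact ⟨_, by rw [h]⟩
  · rintro ⟨e, rfl⟩
    exact ⟨((1 / √2 : ℝ) : ℂ) • e, by
      rw [h, smul_smul, one_mul, mul_comm, sqrt_two_mul_inv, one_smul]⟩

theorem mem_V₂ {ψ : State 3} : ψ ∈ V₂ ↔ ∃ e, ψ = ofDicke (pairVec 0 e) := by
  rw [V₂, mem_sectorSubspace]
  have h (e) := smul_tensor_add_smul_tensor 0 1 0 e
  simp only [one_smul, zero_smul, zero_add, zero_mul] at h
  constructor
  · rintro ⟨e, rfl⟩
    exact ⟨_, by rw [h]⟩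
  · rintro ⟨e, rfl⟩
    exact ⟨((1 / √2 : ℝ) : ℂ) • e, by
      rw [h, smul_smul, one_mul, mul_comm, sqrt_two_mul_inv, one_smul]⟩

theorem sectorAction_zero (κ u : ℝ) : sectorAction κ u 0 = 0 := by
  ext i; fin_cases i <;> simp [sectorAction]

theorem hamiltonian_mulVec_mem_V₁ (u : ℝ) {ψ : State 3} (h : ψ ∈ V₁) :
    hamiltonian 3 u *ᵥ ψ ∈ V₁ := by
  obtain ⟨e, rfl⟩ := mem_V₁.1 h
  rw [hamiltonian_mulVec_pairVec, sectorAction_zero]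
  exact mem_V₁.2 ⟨_, rfl⟩

theorem hamiltonian_mulVec_mem_V₂ (u : ℝ) {ψ : State 3} (h : ψ ∈ V₂) :
    hamiltonian 3 u *ᵥ ψ ∈ V₂ := by
  obtain ⟨e, rfl⟩ := mem_V₂.1 h
  rw [hamiltonian_mulVec_pairVec, sectorAction_zero]
  exact mem_V₂.2 ⟨_, rfl⟩

theorem pairVec_add (e f e' f' : Fin 2 → ℂ) :
    pairVec e f + pairVec e' f' = pairVec (e + e') (f + f') := by
  simp only [pairVec_eq]
  ext i
  fin_cases i <;> simp <;> ring

theorem V₁_sup_V₂ : V₁ ⊔ V₂ = symmetricSector := by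
  apply le_antisymm
  · refine sup_le (fun ψ h => ?_) (fun ψ h => ?_)
    · obtain ⟨e, rfl⟩ := mem_V₁.1 h
      exact ofDicke_mem_symmetricSector _
    · obtain ⟨e, rfl⟩ := mem_V₂.1 h
      exact ofDicke_mem_symmetricSector _
  · intro ψ h
    rw [← range_ofDickeₗ] at h
    obtain ⟨v, rfl⟩ := h
    obtain ⟨e, f, rfl⟩ := exists_pairVec v
    refine Submodule.mem_sup.2 ⟨_, mem_V₁.2 ⟨e, rfl⟩, _, mem_V₂.2 ⟨f, rfl⟩, ?_⟩
    rw [← ofDickeₗ_apply, ← ofDickeₗ_apply, ← map_add, pairVec_add, add_zero, zero_add]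

theorem V₁_inf_V₂ : V₁ ⊓ V₂ = ⊥ := by
  rw [eq_bot_iff]
  rintro ψ ⟨h1, h2⟩
  obtain ⟨e, rfl⟩ := mem_V₁.1 h1
  obtain ⟨f, h⟩ := mem_V₂.1 h2
  obtain ⟨rfl, -⟩ := pairVec_injective (ofDicke_injective h)
  have : pairVec 0 0 = 0 := by rw [pairVec_eq]; ext i; fin_cases i <;> simp
  rw [this, ← ofDickeₗ_apply, map_zero]
  exact Submodule.zero_mem _

/-- Not every symmetric unit vector is reachable, even up to a phase. -/
theorem exists_symmetric_notMem : ∃ ψ ∈ symmetricSector, IsUnitVector ψ ∧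
    ∀ c : ℂ, ‖c‖ = 1 → c • ψ ∉ ofDicke '' setO := by
  -- The GHZ state `(|000⟩ + |111⟩)/√2`: it lies in `V₁`, and no phase gives it a component in `V₂`.
  refine ⟨ofDicke (pairVec ![((√2 : ℝ) : ℂ), 0] 0), ofDicke_mem_symmetricSector _, ?_, ?_⟩
  · rw [isUnitVector_ofDicke, IsUnitVector, sum_norm_pairVec]
    simp
  · rintro c hc ⟨v, hv, h⟩
    obtain ⟨e, f, he, hf, rfl⟩ := (mem_setO_iff v).1 hv
    have : c • pairVec ![((√2 : ℝ) : ℂ), 0] 0 = pairVec (c • ![((√2 : ℝ) : ℂ), 0]) 0 := by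
      simp only [pairVec_eq]
      ext i; fin_cases i <;> simp <;> ring
    rw [← ofDickeₗ_apply (pairVec ![_, _] _), ← map_smul, this, ofDickeₗ_apply] at h
    obtain ⟨-, rfl⟩ := pairVec_injective (ofDicke_injective h)
    simp [IsUnitVector] at hf

/-! ### Reachable states lie in `setO` -/

theorem ket_eq_ofDicke : ket 0 0 0 = ofDicke (pairVec ![1, 0] ![1, 0]) := by
  rw [pairVec_eq]
  simp [ofDicke, dicke, Fin.sum_univ_four]

/-- Equality case of Cauchy–Schwarz: `‖x ∘ τ - x‖² = 2‖x‖² - 2 Re ⟨x, x ∘ τ⟩`. -/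
theorem comp_eq_self_of_re_dotProduct_eq {ι : Type*} [Fintype ι] (τ : Equiv.Perm ι) (x : ι → ℂ)
    (h : (star x ⬝ᵥ (x ∘ τ)).re = (star x ⬝ᵥ x).re) : x ∘ τ = x := by
  have hn : ∑ i, ‖x (τ i) - x i‖ ^ 2 = 0 := by
    have e1 : ∑ i, ‖x (τ i)‖ ^ 2 = ∑ i, ‖x i‖ ^ 2 := Equiv.sum_comp τ fun i => ‖x i‖ ^ 2
    have e2 : (star x ⬝ᵥ x).re = ∑ i, ‖x i‖ ^ 2 := by
      simp only [dotProduct, Complex.re_sum, ← Complex.normSq_eq_norm_sq, Complex.normSq_apply]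
      exact Finset.sum_congr rfl fun i _ => by simp
    have e3 : ∑ i, ‖x (τ i) - x i‖ ^ 2 =
        ∑ i, ‖x (τ i)‖ ^ 2 + ∑ i, ‖x i‖ ^ 2 - 2 * (star x ⬝ᵥ (x ∘ τ)).re := by
      simp only [dotProduct, Complex.re_sum, Finset.mul_sum, ← Finset.sum_add_distrib,
        ← Finset.sum_sub_distrib, ← Complex.normSq_eq_norm_sq, Complex.normSq_apply]
      refine Finset.sum_congr rfl fun i _ => ?_
      simp
      ring
    rw [e3, e1, h, e2]
    ring
  funext i
  have := (Finset.sum_eq_zero_iff_of_nonneg fun i _ => by positivity).1 hn i (Finset.mem_univ i)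
  simpa [sub_eq_zero] using this

theorem reachableSet_subset (𝒰 : Set (ℝ → ℝ)) :
    reachableSet 3 𝒰 (ket 0 0 0) ⊆ ofDicke '' setO := by
  rintro χ ⟨u, -, T, hT, ψ, hψ, h0, rfl⟩
  have hcons {τ} (hτ : IsSymmetry τ) := hψ.re_dotProduct_symmetry hT hτ
  have hn := hcons isSymmetry_refl
  have hsym : ψ T ∈ symmetricSector := by
    intro π a
    have hp := hcons (isSymmetry_perm π)
    refine congrFun (comp_eq_self_of_re_dotProduct_eq
      (π.symm.arrowCongr (Equiv.refl (Fin 2))) (ψ T) ?_) a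
    refine hp.trans (Eq.trans ?_ hn.symm)
    have : ψ 0 ∘ π.symm.arrowCongr (Equiv.refl (Fin 2)) = ψ 0 := by
      rw [h0, ket_eq_ofDicke]
      exact funext fun a => ofDicke_mem_symmetricSector _ π a
    rw [this]; rfl
  obtain ⟨e, f, hef⟩ := exists_pairVec (dickeCoord (ψ T))
  have hψT : ψ T = ofDicke (pairVec e f) := by rw [← hef, ofDicke_dickeCoord hsym]
  have hnorm (x : State 3) : (star x ⬝ᵥ (x ∘ Equiv.refl _)).re = ∑ i, ‖x i‖ ^ 2 := by
    simp only [dotProduct, Complex.re_sum, ← Complex.normSq_eq_norm_sq, Complex.normSq_apply]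
    exact Finset.sum_congr rfl fun i _ => by simp
  -- The flip fixes the difference of the squared norms of `e` and `f`, and the norm fixes their
  -- sum.
  have hfl := hcons isSymmetry_flip
  rw [hψT, h0, ket_eq_ofDicke, re_dotProduct_flip, re_dotProduct_flip] at hfl
  rw [hnorm, hnorm, hψT, h0, ket_eq_ofDicke, sum_norm_ofDicke, sum_norm_ofDicke,
    sum_norm_pairVec, sum_norm_pairVec] at hn
  simp at hn hfl
  refine ⟨_, pairVec_mem_setO_iff.2 ⟨?_, ?_⟩, hψT.symm⟩ <;>
    rw [IsUnitVector, Fin.sum_univ_two] <;> linarith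

open Quaternion

/-! ### Generation of the unit quaternions -/

/-- The quaternion with the given components. -/
def quat (a b c d : ℝ) : ℍ[ℝ] := ⟨a, b, c, d⟩

@[simp] theorem quat_re (a b c d : ℝ) : (quat a b c d).re = a := rfl
@[simp] theorem quat_imI (a b c d : ℝ) : (quat a b c d).imI = b := rfl
@[simp] theorem quat_imJ (a b c d : ℝ) : (quat a b c d).imJ = c := rfl
@[simp] theorem quat_imK (a b c d : ℝ) : (quat a b c d).imK = d := rfl

theorem quat_eta (q : ℍ[ℝ]) : quat q.re q.imI q.imJ q.imK = q := rfl

theorem normSq_quat (a b c d : ℝ) : normSq (quat a b c d) = a ^ 2 + b ^ 2 + c ^ 2 + d ^ 2 :=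
  Quaternion.normSq_def' _

theorem exists_cos_sin {c s : ℝ} (h : c ^ 2 + s ^ 2 = 1) :
    ∃ x, Real.cos x = c ∧ Real.sin x = s := by
  have h1 : ‖(⟨c, s⟩ : ℂ)‖ = 1 := by
    rw [Complex.norm_def, Complex.normSq_mk, ← sq, ← sq, h, Real.sqrt_one]
  have h0 : (⟨c, s⟩ : ℂ) ≠ 0 := by
    intro h0
    simp [h0] at h1
  exact ⟨Complex.arg ⟨c, s⟩, by rw [Complex.cos_arg h0, h1, div_one],
    by rw [Complex.sin_arg, h1, div_one]⟩

theorem exists_polar (a b : ℝ) :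
    ∃ x, a = √(a ^ 2 + b ^ 2) * Real.cos x ∧ b = √(a ^ 2 + b ^ 2) * Real.sin x := by
  have h : ‖(⟨a, b⟩ : ℂ)‖ = √(a ^ 2 + b ^ 2) := by
    rw [Complex.norm_def, Complex.normSq_mk, ← sq, ← sq]
  refine ⟨Complex.arg ⟨a, b⟩, ?_, ?_⟩
  · rw [← h, Complex.norm_mul_cos_arg]
  · rw [← h, Complex.norm_mul_sin_arg]

/-- Rotations about the third axis and about one horizontal axis generate all rotations. -/
theorem mem_of_euler_angles (P : Submonoid ℍ[ℝ]) (η : ℝ)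
    (hk : ∀ c s : ℝ, c ^ 2 + s ^ 2 = 1 → quat c 0 0 s ∈ P)
    (hv : ∀ c s : ℝ, c ^ 2 + s ^ 2 = 1 → quat c (s * Real.cos η) (s * Real.sin η) 0 ∈ P)
    {q : ℍ[ℝ]} (hq : normSq q = 1) : q ∈ P := by
  obtain ⟨r, i, j, k, rfl⟩ : ∃ r i j k, q = quat r i j k := ⟨_, _, _, _, (quat_eta q).symm⟩
  rw [normSq_quat] at hq
  obtain ⟨x, hx, hx'⟩ := exists_polar r k
  obtain ⟨y, hy, hy'⟩ := exists_polar i j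
  have hkt (t : ℝ) := hk (Real.cos t) (Real.sin t) (Real.cos_sq_add_sin_sq t)
  -- With half-angles `a` and `b` about the third axis on the two sides, the product has polar
  -- angles `a + b` in `(r, k)` and `a - b + η` in `(i, j)`; solving for `x` and `y` gives these
  -- values.
  have key := P.mul_mem (P.mul_mem (hkt ((x + y - η) / 2))
    (hv (√(r ^ 2 + k ^ 2)) (√(i ^ 2 + j ^ 2)) (by
      rw [Real.sq_sqrt (by positivity), Real.sq_sqrt (by positivity), ← hq]; ring)))
    (hkt ((x - y + η) / 2))
  refine (congrArg (· ∈ P) ?_).mpr key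
  have ex : x = (x + y - η) / 2 + (x - y + η) / 2 := by ring
  have ey : y = (x + y - η) / 2 - (x - y + η) / 2 + η := by ring
  generalize (x + y - η) / 2 = a at *
  generalize (x - y + η) / 2 = b at *
  generalize √(r ^ 2 + k ^ 2) = m at *
  generalize √(i ^ 2 + j ^ 2) = n at *
  subst ex
  rw [ey] at hy hy'
  rw [hx, hx', hy, hy']
  apply Quaternion.ext <;> simp [Real.cos_add, Real.sin_add, Real.cos_sub, Real.sin_sub] <;> ring

/-- The rotation axis of the transverse field in the sector with sign `κ`. -/
theorem mem_of_tilted_axis (P : Submonoid ℍ[ℝ]) (κ : ℝ) (hκ : κ ^ 2 = 1)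
    (hk : ∀ c s : ℝ, c ^ 2 + s ^ 2 = 1 → quat c 0 0 s ∈ P)
    (hm : ∀ c s : ℝ, c ^ 2 + s ^ 2 = 1 → quat c (s * (√3 / 2)) 0 (-(s * (κ / 2))) ∈ P)
    {q : ℍ[ℝ]} (hq : normSq q = 1) : q ∈ P := by
  have h2 : √2 ^ 2 = 2 := Real.sq_sqrt (by norm_num)
  have h3 : √3 ^ 2 = 3 := Real.sq_sqrt (by norm_num)
  have h33 : √3 ^ 3 = 3 * √3 := by rw [pow_succ, h3]
  have h34 : √3 ^ 4 = 9 := by rw [show √3 ^ 4 = (√3 ^ 2) ^ 2 by ring, h3]; norm_num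
  -- The rotation about the tilted axis by the angle of cosine `-1/3` makes the third axis
  -- horizontal, in direction `η`. Its quaternion has `c² = 1/3` and `s² = 2/3`.
  have hw : (√3 / 3) ^ 2 + (√2 * √3 / 3) ^ 2 = 1 := by
    rw [div_pow, div_pow, mul_pow, h2, h3]; norm_num
  have hw' : (√3 / 3) ^ 2 + (-(√2 * √3 / 3)) ^ 2 = 1 := by rw [neg_sq, hw]
  obtain ⟨η, hc, hs⟩ := exists_cos_sin (c := -(κ * √3 / 3)) (s := -(√2 * √3 / 3)) (by
    rw [neg_sq, neg_sq, div_pow, div_pow, mul_pow, mul_pow, h2, h3, hκ]; norm_num)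
  refine mem_of_euler_angles P η hk (fun c s hcs => ?_) hq
  have key := P.mul_mem (P.mul_mem (hm _ _ hw) (hk c s hcs)) (hm _ _ hw')
  refine (congrArg (· ∈ P) ?_).mpr key
  rw [hc, hs]
  apply Quaternion.ext <;> simp <;> ring_nf <;> simp only [h2, h3, h33, h34, hκ] <;> ring

/-- Unit quaternions with equal real parts are conjugate. -/
theorem exists_conj {p q : ℍ[ℝ]} (hp : normSq p = 1) (hq : normSq q = 1) (h : p.re = q.re) :
    ∃ g : ℍ[ℝ], normSq g = 1 ∧ g * p * star g = q := by
  suffices ∃ g : ℍ[ℝ], g ≠ 0 ∧ g * p = q * g by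
    obtain ⟨g, h0, hg⟩ := this
    have hn : 0 < normSq g := lt_of_le_of_ne normSq_nonneg (Ne.symm (normSq_ne_zero.2 h0))
    have hs : (√(normSq g))⁻¹ * (√(normSq g))⁻¹ * normSq g = 1 := by
      rw [← mul_inv, Real.mul_self_sqrt hn.le, inv_mul_cancel₀ hn.ne']
    refine ⟨(√(normSq g))⁻¹ • g, ?_, ?_⟩
    · rw [normSq_smul, sq, hs]
    · rw [smul_mul_assoc, hg, Quaternion.star_smul, smul_mul_smul_comm, mul_assoc,
        self_mul_star, ← Quaternion.coe_mul_eq_smul, ← mul_assoc, ← Quaternion.coe_commutes,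
        ← mul_assoc, ← Quaternion.coe_mul, mul_comm (normSq g), hs, Quaternion.coe_one, one_mul]
  obtain ⟨r, a, b, c, rfl⟩ : ∃ r a b c, p = quat r a b c := ⟨_, _, _, _, (quat_eta p).symm⟩
  obtain ⟨r', a', b', c', rfl⟩ : ∃ r a b c, q = quat r a b c := ⟨_, _, _, _, (quat_eta q).symm⟩
  simp only [quat_re] at h
  subst h
  rw [normSq_quat] at hp hq
  -- For imaginary parts `P` and `Q` of equal norm, `P² = Q²`, so `P + Q` intertwines them. If `Q =
  -- -P`, any imaginary quaternion orthogonal to `P` does.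
  by_cases hv : a + a' = 0 ∧ b + b' = 0 ∧ c + c' = 0
  · obtain ⟨ha, hb, hc⟩ := hv
    obtain rfl : a' = -a := by linarith
    obtain rfl : b' = -b := by linarith
    obtain rfl : c' = -c := by linarith
    by_cases hab : a = 0 ∧ b = 0
    · obtain ⟨rfl, rfl⟩ := hab
      refine ⟨quat 0 1 0 0, fun h => ?_, ?_⟩
      · simpa using congrArg (fun x : ℍ[ℝ] => x.imI) h
      · apply Quaternion.ext <;> simp
    · refine ⟨quat 0 (-b) a 0, fun h => hab ⟨?_, ?_⟩, ?_⟩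
      · simpa using congrArg (fun x : ℍ[ℝ] => x.imJ) h
      · simpa using congrArg (fun x : ℍ[ℝ] => x.imI) h
      · apply Quaternion.ext <;> simp <;> ring
  · refine ⟨quat 0 (a + a') (b + b') (c + c'), fun h => hv ⟨?_, ?_, ?_⟩, ?_⟩
    · simpa using congrArg (fun x : ℍ[ℝ] => x.imI) h
    · simpa using congrArg (fun x : ℍ[ℝ] => x.imJ) h
    · simpa using congrArg (fun x : ℍ[ℝ] => x.imK) h
    · apply Quaternion.ext <;> simp <;> linarith

theorem exists_unit_orthogonal (a b c : ℝ) :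
    ∃ p : ℍ[ℝ], normSq p = 1 ∧ p.re = 0 ∧ a * p.imI + b * p.imJ + c * p.imK = 0 := by
  by_cases hab : a ^ 2 + b ^ 2 = 0
  · refine ⟨quat 0 1 0 0, by rw [normSq_quat]; norm_num, rfl, ?_⟩
    have : a = 0 := by nlinarith [sq_nonneg b]
    simp [this]
  · have h1 : √(a ^ 2 + b ^ 2) ≠ 0 :=
      Real.sqrt_ne_zero'.2 (lt_of_le_of_ne (by positivity) (Ne.symm hab))
    refine ⟨quat 0 (-b / √(a ^ 2 + b ^ 2)) (a / √(a ^ 2 + b ^ 2)) 0, ?_, rfl, ?_⟩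
    · rw [normSq_quat, div_pow, div_pow, Real.sq_sqrt (by positivity)]
      field_simp
      ring
    · simp only [quat_imI, quat_imJ, quat_imK]
      ring

/-- A subgroup of `(U(1) × SU(2))²` contains the second `SU(2)` if it projects onto it and has an
element that is central in the first component and far from central in the second. -/
theorem mem_of_normal_generation (G : Submonoid ((ℂ × ℍ[ℝ]) × (ℂ × ℍ[ℝ])))
    (hstar : ∀ g ∈ G, star g ∈ G) (hunit : ∀ g ∈ G, g * star g = 1)
    (hproj : ∀ q : ℍ[ℝ], normSq q = 1 → ∃ g ∈ G, g.2.2 = q)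
    (hex : ∃ g ∈ G, g.1.2 = -1 ∧ g.2.2.re = -1 / 9)
    {q : ℍ[ℝ]} (hq : normSq q = 1) : ((1, 1), (1, q)) ∈ G := by
  have hns {q : ℍ[ℝ]} (hq : normSq q = 1) : star q * q = 1 := by
    rw [Quaternion.star_mul_self, hq, Quaternion.coe_one]
  -- Conjugation by group elements leaves the phases and a central `r` alone and moves `h` through
  -- its whole conjugacy class.
  have hconj {l m : ℂ} {r h h' : ℍ[ℝ]} (hr : ∀ x y : ℍ[ℝ], x * y = 1 → x * r * y = r)
      (hG : ((l, r), (m, h)) ∈ G) (hh : normSq h = 1) (hh' : normSq h' = 1) (hre : h.re = h'.re) :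
      ((l, r), (m, h')) ∈ G := by
    obtain ⟨p, hp, rfl⟩ := exists_conj hh hh' hre
    obtain ⟨⟨⟨z₁, q₁⟩, ⟨z₂, q₂⟩⟩, hg, rfl⟩ := hproj p hp
    have hu := hunit _ hg
    simp only [Prod.star_def, Prod.mk_mul_mk, Prod.mk_eq_one] at hu
    obtain ⟨⟨h1, h2⟩, ⟨h3, h4⟩⟩ := hu
    have := G.mul_mem (G.mul_mem hg hG) (hstar _ hg)
    simpa only [Prod.star_def, Prod.mk_mul_mk, hr _ _ h2, mul_right_comm _ _ (star _), h1, h3,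
      one_mul] using this
  obtain ⟨⟨⟨l, r⟩, ⟨m, h⟩⟩, hg, hr, hre⟩ := hex
  simp only at hr hre
  subst hr
  have hh : normSq h = 1 := by
    have hu := hunit _ hg
    simp only [Prod.star_def, Prod.mk_mul_mk, Prod.mk_eq_one] at hu
    have := hu.2.2
    rw [Quaternion.self_mul_star, ← Quaternion.coe_one] at this
    exact Quaternion.coe_injective this
  have hC {h' : ℍ[ℝ]} (hh' : normSq h' = 1) (h9 : h'.re = -1 / 9) : ((l, -1), (m, h')) ∈ G :=
    hconj (fun x y hxy => by simp [hxy]) hg hh hh' (hre.trans h9.symm)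
  set i : ℍ[ℝ] := quat 0 1 0 0 with hi
  have hin : normSq i = 1 := by rw [hi, normSq_quat]; norm_num
  have hI : ((l * l, 1), (m * m, i)) ∈ G := by
    -- `k` is chosen so that both `k` and `i k̄` have real part `-1/9`; their product is `i`, and
    -- `(-1)(-1) = 1` in the first sector.
    set k : ℍ[ℝ] := quat (-1 / 9) (-1 / 9) (√(1 - 2 * (1 / 9) ^ 2)) 0 with hk
    have hkn : normSq k = 1 := by
      rw [hk, normSq_quat, Real.sq_sqrt (by norm_num)]; norm_num
    have h1 : normSq (i * star k) = 1 := by rw [map_mul, Quaternion.normSq_star, hin, hkn, one_mul]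
    have := G.mul_mem (hC h1 (by simp [hi, hk])) (hC hkn rfl)
    simpa only [Prod.mk_mul_mk, mul_assoc, hns hkn, mul_one, neg_mul_neg] using this
  have hP {p : ℍ[ℝ]} (hp : normSq p = 1) (hp0 : p.re = 0) : ((l * l, 1), (m * m, p)) ∈ G :=
    hconj (fun x y hxy => by simp [hxy]) hI hin hp hp0.symm
  have hall {p : ℍ[ℝ]} (hp : normSq p = 1) :
      ((l * l * (l * l), 1), (m * m * (m * m), p)) ∈ G := by
    -- If `k` is imaginary and orthogonal to `p`, then `p k̄` is imaginary, so `p = (p k̄) k` is a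
    -- product of two imaginary units.
    obtain ⟨k, hkn, hk0, hk⟩ := exists_unit_orthogonal p.imI p.imJ p.imK
    have h1 : normSq (p * star k) = 1 := by rw [map_mul, Quaternion.normSq_star, hp, hkn, one_mul]
    have := G.mul_mem (hP h1 (by simp [hk0]; linarith)) (hP hkn hk0)
    simpa only [Prod.mk_mul_mk, mul_assoc, hns hkn, mul_one] using this
  -- The phases do not depend on `p`, so dividing by the element for `p = 1` removes them.
  have h1 := hall (p := 1) (map_one _)
  have hu := hunit _ h1
  have := G.mul_mem (hall hq) (hstar _ h1)
  simp only [Prod.star_def, Prod.mk_mul_mk, Prod.mk_eq_one] at hu this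
  rwa [hu.1.1, hu.2.1, star_one, mul_one, mul_one] at this

/-! ### Reachable states in quaternionic coordinates -/

/-- The vector `z • (q e₀)`, where the quaternion `q` acts by the Pauli matrices
`i ↦ -i σx`, `j ↦ -i σy`, `k ↦ -i σz`. -/
noncomputable def spinor (z : ℂ) (q : ℍ[ℝ]) : Fin 2 → ℂ :=
  ![z * (q.re - Complex.I * q.imK), z * (q.imJ - Complex.I * q.imI)]

theorem exists_spinor {e : Fin 2 → ℂ} (he : IsUnitVector e) :
    ∃ q : ℍ[ℝ], normSq q = 1 ∧ spinor 1 q = e := by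
  refine ⟨quat (e 0).re (-(e 1).im) (e 1).re (-(e 0).im), ?_, ?_⟩
  · rw [normSq_quat, ← he]
    simp only [Fin.sum_univ_two, ← Complex.normSq_eq_norm_sq, Complex.normSq_apply]
    ring
  · ext i
    fin_cases i <;> apply Complex.ext <;> simp [spinor]

/-- The phase rate of the sector with sign `κ` at control value `0` or `1`. -/
def phaseRate (κ : ℝ) (b : Bool) : ℝ := if b then κ else 1

/-- The infinitesimal rotation of the sector with sign `κ` at control value `0` or `1`. -/
noncomputable def axis (κ : ℝ) (b : Bool) : ℍ[ℝ] :=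
  if b then quat 0 √3 0 (-κ) else quat 0 0 0 2

/-- The control value. -/
def level (b : Bool) : ℝ := if b then 1 else 0

/-- The sector matrix is `1 + 2σz` at control 0 and `κ + √3 σx - κ σz` at control 1: the scalar part
is the phase rate, the traceless part the axis. -/
theorem neg_I_smul_sectorAction (κ : ℝ) (b : Bool) (z : ℂ) (q : ℍ[ℝ]) :
    (-Complex.I) • sectorAction κ (level b) (spinor z q) =
      (-Complex.I * phaseRate κ b) • spinor z q + spinor z (axis κ b * q) := by
  ext i
  cases b <;> fin_cases i <;> apply Complex.ext <;>
    simp [sectorAction, level, phaseRate, axis, spinor] <;> ring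

/-- Both axes have length 2, since `(√3)² + κ² = 4`. Hence `rotation` is the exponential of `t •
axis`, and all rotations share a period. -/
theorem axis_mul_axis_mul {κ : ℝ} (hκ : κ ^ 2 = 1) (b : Bool) (q : ℍ[ℝ]) :
    axis κ b * (axis κ b * q) = (-4 : ℝ) • q := by
  have h3 : √3 * √3 = 3 := Real.mul_self_sqrt (by norm_num)
  have : axis κ b * axis κ b = ((-4 : ℝ) : ℍ[ℝ]) := by
    cases b <;> apply Quaternion.ext <;> simp [axis, h3] <;> nlinarith
  rw [← mul_assoc, this, Quaternion.coe_mul_eq_smul]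

/-- The rotation generated by `axis κ b`. -/
noncomputable def rotation (κ : ℝ) (b : Bool) (t : ℝ) : ℍ[ℝ] :=
  ((Real.cos (2 * t) : ℝ) : ℍ[ℝ]) + (Real.sin (2 * t) / 2) • axis κ b

/-- The phase factor at time `t`. -/
noncomputable def phaseFactor (κ : ℝ) (b : Bool) (t : ℝ) : ℂ :=
  Complex.exp (-Complex.I * phaseRate κ b * t)

theorem spinor_add (z : ℂ) (p q : ℍ[ℝ]) : spinor z (p + q) = spinor z p + spinor z q := by
  ext i; fin_cases i <;> simp [spinor] <;> ring

theorem spinor_smul (z : ℂ) (r : ℝ) (q : ℍ[ℝ]) : spinor z (r • q) = (r : ℂ) • spinor z q := by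
  ext i; fin_cases i <;> simp [spinor] <;> ring

theorem spinor_mul (w z : ℂ) (q : ℍ[ℝ]) : spinor (w * z) q = w • spinor z q := by
  ext i; fin_cases i <;> simp [spinor] <;> ring

theorem hasDerivAt_spinor {κ : ℝ} (hκ : κ ^ 2 = 1) (b : Bool) (z : ℂ) (q : ℍ[ℝ]) (t : ℝ) :
    HasDerivAt (fun t => spinor (phaseFactor κ b t * z) (rotation κ b t * q))
      ((-Complex.I) • sectorAction κ (level b)
        (spinor (phaseFactor κ b t * z) (rotation κ b t * q))) t := by
  have hexp (t : ℝ) : spinor (phaseFactor κ b t * z) (rotation κ b t * q) =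
      phaseFactor κ b t • (((Real.cos (2 * t) : ℝ) : ℂ) • spinor z q +
        ((Real.sin (2 * t) / 2 : ℝ) : ℂ) • spinor z (axis κ b * q)) := by
    rw [spinor_mul, rotation, add_mul, Quaternion.coe_mul_eq_smul, smul_mul_assoc, spinor_add,
      spinor_smul, spinor_smul]
  have h1 : HasDerivAt (phaseFactor κ b) (-Complex.I * phaseRate κ b * phaseFactor κ b t) t := by
    have := ((hasDerivAt_id t).ofReal_comp.const_mul (-Complex.I * phaseRate κ b)).cexp
    refine this.congr_deriv ?_
    simp [phaseFactor, mul_comm]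
  have h2 : HasDerivAt (fun t : ℝ => ((Real.cos (2 * t) : ℝ) : ℂ))
      ((-(2 * Real.sin (2 * t)) : ℝ) : ℂ) t := by
    have := (((hasDerivAt_id t).const_mul 2).cos).ofReal_comp
    simpa [mul_comm] using this
  have h3 : HasDerivAt (fun t : ℝ => ((Real.sin (2 * t) / 2 : ℝ) : ℂ))
      ((Real.cos (2 * t) : ℝ) : ℂ) t := by
    have := ((((hasDerivAt_id t).const_mul 2).sin).div_const 2).ofReal_comp
    simpa [mul_comm] using this
  have key := h1.smul ((h2.smul_const (spinor z q)).add
    (h3.smul_const (spinor z (axis κ b * q))))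
  rw [neg_I_smul_sectorAction]
  simp only [hexp]
  refine key.congr_deriv ?_
  rw [rotation, add_mul, Quaternion.coe_mul_eq_smul, smul_mul_assoc, mul_add, mul_smul_comm,
    mul_smul_comm, axis_mul_axis_mul hκ, spinor_add, spinor_smul, spinor_smul, spinor_smul,
    spinor_mul, spinor_mul]
  ext i
  simp
  ring

/-- The states in quaternionic coordinates. -/
noncomputable def quatState (g : (ℂ × ℍ[ℝ]) × (ℂ × ℍ[ℝ])) : State 3 :=
  ofDicke (pairVec (spinor g.1.1 g.1.2) (spinor g.2.1 g.2.2))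

theorem quatState_one : quatState 1 = ket 0 0 0 := by
  rw [ket_eq_ofDicke, quatState]
  congr 2 <;> ext i <;> fin_cases i <;> simp [spinor]

/-- The flow for time `t` at a constant control. -/
noncomputable def flow (b : Bool) (t : ℝ) : (ℂ × ℍ[ℝ]) × (ℂ × ℍ[ℝ]) :=
  ((phaseFactor 1 b t, rotation 1 b t), (phaseFactor (-1) b t, rotation (-1) b t))

theorem flow_zero (b : Bool) : flow b 0 = 1 := by
  simp [flow, phaseFactor, rotation, Prod.ext_iff]

theorem smul_ofDicke_pairVec (c : ℂ) (e f : Fin 2 → ℂ) :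
    c • ofDicke (pairVec e f) = ofDicke (pairVec (c • e) (c • f)) := by
  rw [← ofDickeₗ_apply, ← map_smul, ofDickeₗ_apply]
  congr 1
  simp only [pairVec_eq]
  ext i; fin_cases i <;> simp <;> ring

/-- The vector `ofDicke (pairVec e f)` as a linear function of `(e, f)`. -/
noncomputable def pairState : ((Fin 2 → ℂ) × (Fin 2 → ℂ)) →ₗ[ℂ] State 3 where
  toFun p := ofDicke (pairVec p.1 p.2)
  map_add' p p' := by
    rw [← ofDickeₗ_apply, ← ofDickeₗ_apply, ← ofDickeₗ_apply, ← map_add, pairVec_add]; rfl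
  map_smul' c p := (smul_ofDicke_pairVec c p.1 p.2).symm

theorem hasDerivAt_flow_mul (b : Bool) (g : (ℂ × ℍ[ℝ]) × (ℂ × ℍ[ℝ])) (t : ℝ) :
    HasDerivAt (fun t => quatState (flow b t * g))
      ((-Complex.I) • (hamiltonian 3 (level b) *ᵥ quatState (flow b t * g))) t := by
  have h1 := hasDerivAt_spinor (κ := 1) (by norm_num) b g.1.1 g.1.2 t
  have h2 := hasDerivAt_spinor (κ := -1) (by norm_num) b g.2.1 g.2.2 t
  have key := ((LinearMap.toContinuousLinearMap pairState).restrictScalars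
    ℝ).hasFDerivAt.comp_hasDerivAt t (h1.prodMk h2)
  rw [quatState, hamiltonian_mulVec_pairVec, smul_ofDicke_pairVec]
  exact key

theorem flow_add_two_pi (b : Bool) (t : ℝ) (n : ℕ) : flow b (t + n * (2 * Real.pi)) = flow b t := by
  have h1 (κ : ℝ) : rotation κ b (t + n * (2 * Real.pi)) = rotation κ b t := by
    have : 2 * (t + n * (2 * Real.pi)) = 2 * t + ((2 * n : ℕ) : ℝ) * (2 * Real.pi) := by
      push_cast; ring
    rw [rotation, this, Real.cos_add_nat_mul_two_pi, Real.sin_add_nat_mul_two_pi, rotation]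
  have h2 {κ : ℝ} (hκ : κ = 1 ∨ κ = -1) :
      phaseFactor κ b (t + n * (2 * Real.pi)) = phaseFactor κ b t := by
    have hr : phaseRate κ b = 1 ∨ phaseRate κ b = -1 := by
      cases b
      · exact Or.inl rfl
      · exact hκ
    rw [phaseFactor, phaseFactor]
    rcases hr with hr | hr <;> rw [hr, Complex.exp_eq_exp_iff_exists_int]
    · exact ⟨-n, by push_cast; ring⟩
    · exact ⟨n, by push_cast; ring⟩
  simp only [flow, h1, h2 (Or.inl rfl), h2 (Or.inr rfl)]

/-- A flow for negative time equals one for positive time after adding periods, so inverses are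
reachable. -/
theorem quatState_flow_mul_mem (b : Bool) (t : ℝ) (g : (ℂ × ℍ[ℝ]) × (ℂ × ℍ[ℝ]))
    (hg : quatState g ∈ reachableSet 3 bangBang (ket 0 0 0)) :
    quatState (flow b t * g) ∈ reachableSet 3 bangBang (ket 0 0 0) := by
  obtain ⟨n, hn⟩ := exists_nat_ge (-t / (2 * Real.pi))
  rw [div_le_iff₀ Real.two_pi_pos] at hn
  rw [← flow_add_two_pi b t n]
  exact reachableSet_bangBang_extend hg (b := level b) (by cases b <;> simp [level])
    (hasDerivAt_flow_mul b g) (by rw [flow_zero, one_mul]) (by linarith)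

/-! ### The group of reachable motions and the independence of the two sectors -/

/-- The group generated by the flows. -/
noncomputable def flowGroup : Submonoid ((ℂ × ℍ[ℝ]) × (ℂ × ℍ[ℝ])) :=
  Submonoid.closure (Set.range fun p : Bool × ℝ => flow p.1 p.2)

theorem flow_mem (b : Bool) (t : ℝ) : flow b t ∈ flowGroup :=
  Submonoid.subset_closure ⟨(b, t), rfl⟩

theorem quatState_mem_of_mem {g : (ℂ × ℍ[ℝ]) × (ℂ × ℍ[ℝ])} (hg : g ∈ flowGroup) :
    quatState g ∈ reachableSet 3 bangBang (ket 0 0 0) := by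
  induction hg using Submonoid.closure_induction_left with
  | one => rw [quatState_one]; exact self_mem_reachableSet _
  | mul_left x hx y _ ih =>
    obtain ⟨⟨b, t⟩, rfl⟩ := hx
    exact quatState_flow_mul_mem b t y ih

theorem star_phaseFactor (κ : ℝ) (b : Bool) (t : ℝ) :
    star (phaseFactor κ b t) = phaseFactor κ b (-t) := by
  rw [phaseFactor, phaseFactor, Complex.star_def, ← Complex.exp_conj]
  simp

theorem star_axis (κ : ℝ) (b : Bool) : star (axis κ b) = -axis κ b := by
  cases b <;> apply Quaternion.ext <;> simp [axis]

theorem star_rotation (κ : ℝ) (b : Bool) (t : ℝ) :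
    star (rotation κ b t) = rotation κ b (-t) := by
  simp [rotation, star_axis, neg_div]

theorem star_flow (b : Bool) (t : ℝ) : star (flow b t) = flow b (-t) := by
  simp only [flow, Prod.star_def, star_phaseFactor, star_rotation]

theorem phaseFactor_mul_star (κ : ℝ) (b : Bool) (t : ℝ) :
    phaseFactor κ b t * star (phaseFactor κ b t) = 1 := by
  rw [star_phaseFactor, phaseFactor, phaseFactor, ← Complex.exp_add]
  simp

theorem rotation_mul_star {κ : ℝ} (hκ : κ ^ 2 = 1) (b : Bool) (t : ℝ) :
    rotation κ b t * star (rotation κ b t) = 1 := by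
  have h3 : √3 ^ 2 = 3 := Real.sq_sqrt (by norm_num)
  have h := Real.cos_sq_add_sin_sq (2 * t)
  rw [Quaternion.self_mul_star, ← Quaternion.coe_one]
  congr 1
  rw [Quaternion.normSq_def']
  cases b
  · simp [rotation, axis, h]
  · simp [rotation, axis, mul_pow, div_pow, h3, hκ]
    linarith

theorem flow_mul_star (b : Bool) (t : ℝ) : flow b t * star (flow b t) = 1 := by
  simp only [flow, Prod.star_def, Prod.mk_mul_mk, phaseFactor_mul_star,
    rotation_mul_star (show (1 : ℝ) ^ 2 = 1 by norm_num),
    rotation_mul_star (show (-1 : ℝ) ^ 2 = 1 by norm_num)]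
  rfl

theorem star_mem_flowGroup {g : (ℂ × ℍ[ℝ]) × (ℂ × ℍ[ℝ])} (hg : g ∈ flowGroup) :
    star g ∈ flowGroup := by
  induction hg using Submonoid.closure_induction with
  | mem x hx =>
    obtain ⟨⟨b, t⟩, rfl⟩ := hx
    simp only [star_flow]
    exact flow_mem _ _
  | one => rw [star_one]; exact flowGroup.one_mem
  | mul x y _ _ hx hy => rw [star_mul]; exact flowGroup.mul_mem hy hx

theorem mul_star_of_mem_flowGroup {g : (ℂ × ℍ[ℝ]) × (ℂ × ℍ[ℝ])} (hg : g ∈ flowGroup) :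
    g * star g = 1 := by
  induction hg using Submonoid.closure_induction with
  | mem x hx =>
    obtain ⟨⟨b, t⟩, rfl⟩ := hx
    exact flow_mul_star b t
  | one => simp
  | mul x y _ _ hx hy => rw [star_mul, mul_assoc, ← mul_assoc y, hy, one_mul, hx]

/-- One time serves both sectors: only the axis depends on `κ`, not the half-angle. -/
theorem exists_rotation {c s : ℝ} (h : c ^ 2 + s ^ 2 = 1) : ∃ t, ∀ κ,
    rotation κ false t = quat c 0 0 s ∧
    rotation κ true t = quat c (s * (√3 / 2)) 0 (-(s * (κ / 2))) := by
  obtain ⟨x, rfl, rfl⟩ := exists_cos_sin h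
  refine ⟨x / 2, fun κ => ⟨?_, ?_⟩⟩ <;> rw [rotation, mul_div_cancel₀ _ two_ne_zero] <;>
    apply Quaternion.ext <;> simp [axis] <;> ring

theorem mul_self_eq {p : ℍ[ℝ]} (hp : normSq p = 1) : p * p = ((2 * p.re : ℝ) : ℍ[ℝ]) * p - 1 := by
  have h : star p = ((2 * p.re : ℝ) : ℍ[ℝ]) - p := by
    apply Quaternion.ext <;> simp
    ring
  have h1 : star p * p = 1 := by rw [Quaternion.star_mul_self, hp, Quaternion.coe_one]
  rw [h, sub_mul] at h1
  rw [← h1, sub_sub_cancel]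

theorem normSq_rotation {κ : ℝ} (hκ : κ ^ 2 = 1) (b : Bool) (t : ℝ) :
    normSq (rotation κ b t) = 1 := by
  have h := rotation_mul_star hκ b t
  rw [Quaternion.self_mul_star, ← Quaternion.coe_one] at h
  exact Quaternion.coe_injective h

/-- A product of two rotations whose square is central in one sector but not in the other. -/
theorem exists_word {κ : ℝ} (hκ : κ ^ 2 = 1) : ∃ s t,
    (rotation (-κ) false s * rotation (-κ) true t) * (rotation (-κ) false s * rotation (-κ) true t)
      = -1 ∧
    ((rotation κ false s * rotation κ true t) * (rotation κ false s * rotation κ true t)).re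
      = -1 / 9 := by
  have hκ' : (-κ) ^ 2 = 1 := by rw [neg_sq, hκ]
  -- In sector `ν` the word has real part `c² + κν d²/2`. With `c² = d²/2` it vanishes for `ν = -κ`,
  -- so the square is `-1`; for `ν = κ` it is `2/3`, and the square has real part `2(2/3)² - 1 =
  -- -1/9`.
  obtain ⟨c, hc⟩ : ∃ c : ℝ, c ^ 2 = 1 / 3 := ⟨√(1 / 3), Real.sq_sqrt (by norm_num)⟩
  obtain ⟨d, hd⟩ : ∃ d : ℝ, d ^ 2 = 2 / 3 := ⟨√(2 / 3), Real.sq_sqrt (by norm_num)⟩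
  obtain ⟨s, hs⟩ := exists_rotation (c := c) (s := d) (by rw [hc, hd]; norm_num)
  obtain ⟨t, ht⟩ := exists_rotation (c := c) (s := κ * d) (by
    rw [mul_pow, hc, hd, hκ]; norm_num)
  have hn {ν : ℝ} (hν : ν ^ 2 = 1) : normSq (rotation ν false s * rotation ν true t) = 1 := by
    rw [map_mul, normSq_rotation hν, normSq_rotation hν, one_mul]
  have hre (ν : ℝ) : (rotation ν false s * rotation ν true t).re = 1 / 3 + κ * ν / 3 := by
    rw [(hs ν).1, (ht ν).2]
    simp
    linear_combination hc + κ * ν / 2 * hd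
  refine ⟨s, t, ?_, ?_⟩
  · rw [mul_self_eq (hn hκ'), hre, show 2 * (1 / 3 + κ * -κ / 3) = 0 by linarith]
    simp
  · rw [mul_self_eq (hn hκ), Quaternion.coe_mul_eq_smul, Quaternion.re_sub, Quaternion.re_smul,
      Quaternion.re_one, hre, smul_eq_mul, ← sq κ, hκ]
    norm_num

/-- The flows generate the full group of independent rotations of the two sectors. -/
theorem one_unitQuaternion_mem_flowGroup {q : ℍ[ℝ]} (hq : normSq q = 1) :
    ((1, 1), (1, q)) ∈ flowGroup ∧ ((1, q), (1, 1)) ∈ flowGroup := by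
  have hproj {κ : ℝ} (hκ : κ ^ 2 = 1) (π : (ℂ × ℍ[ℝ]) × (ℂ × ℍ[ℝ]) →* ℍ[ℝ])
      (hπ : ∀ b t, π (flow b t) = rotation κ b t) (q : ℍ[ℝ]) (hq : normSq q = 1) :
      q ∈ flowGroup.map π := by
    refine mem_of_tilted_axis _ κ hκ (fun c s h => ?_) (fun c s h => ?_) hq
    · obtain ⟨t, ht⟩ := exists_rotation h
      exact ⟨_, flow_mem false t, by rw [hπ, (ht κ).1]⟩
    · obtain ⟨t, ht⟩ := exists_rotation h
      exact ⟨_, flow_mem true t, by rw [hπ, (ht κ).2]⟩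
  constructor
  · refine mem_of_normal_generation flowGroup (fun _ => star_mem_flowGroup)
      (fun _ => mul_star_of_mem_flowGroup) (fun q hq => ?_) ?_ hq
    · exact hproj (κ := -1) (by norm_num) ((MonoidHom.snd _ _).comp (MonoidHom.snd _ _))
        (fun _ _ => rfl) q hq
    · obtain ⟨s, t, h1, h2⟩ := exists_word (κ := -1) (by norm_num)
      rw [neg_neg] at h1
      have hw := flowGroup.mul_mem (flow_mem false s) (flow_mem true t)
      exact ⟨_, flowGroup.mul_mem hw hw, h1, h2⟩
  -- Exchanging the sectors reduces this to the same generation lemma.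
  · let σ : (ℂ × ℍ[ℝ]) × (ℂ × ℍ[ℝ]) →* (ℂ × ℍ[ℝ]) × (ℂ × ℍ[ℝ]) :=
      (MonoidHom.snd _ _).prod (MonoidHom.fst _ _)
    refine mem_of_normal_generation (flowGroup.comap σ)
      (fun g hg => star_mem_flowGroup (g := σ g) hg) (fun g hg => ?_) (fun q hq => ?_) ?_ hq
    · have := mul_star_of_mem_flowGroup (g := σ g) hg
      exact congrArg σ this
    · obtain ⟨g, hg, h⟩ := hproj (κ := 1) (by norm_num)
        ((MonoidHom.snd _ _).comp (MonoidHom.fst _ _)) (fun _ _ => rfl) q hq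
      exact ⟨σ g, hg, h⟩
    · obtain ⟨s, t, h1, h2⟩ := exists_word (κ := 1) (by norm_num)
      have hw := flowGroup.mul_mem (flow_mem false s) (flow_mem true t)
      exact ⟨σ (flow false s * flow true t * (flow false s * flow true t)),
        flowGroup.mul_mem hw hw, h1, h2⟩

theorem ofDicke_mem_reachableSet {v : Fin 4 → ℂ} (hv : v ∈ setO) :
    ofDicke v ∈ reachableSet 3 bangBang (ket 0 0 0) := by
  obtain ⟨e, f, he, hf, rfl⟩ := (mem_setO_iff v).1 hv
  obtain ⟨p, hp, rfl⟩ := exists_spinor he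
  obtain ⟨q, hq, rfl⟩ := exists_spinor hf
  have := quatState_mem_of_mem (flowGroup.mul_mem
    (one_unitQuaternion_mem_flowGroup hp).2 (one_unitQuaternion_mem_flowGroup hq).1)
  simpa [quatState] using this

/-- The states reachable from `|000⟩`. -/
theorem reachableSet_eq {𝒰 : Set (ℝ → ℝ)} (h : bangBang ⊆ 𝒰) :
    reachableSet 3 𝒰 (ket 0 0 0) = ofDicke '' setO := by
  refine (reachableSet_subset 𝒰).antisymm ?_
  rintro _ ⟨v, hv, rfl⟩
  exact reachableSet_mono h _ (ofDicke_mem_reachableSet hv)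

/-! ### The three-tangle -/

/-- The squared concurrences and the off-diagonal term only decrease the tangle, and the diagonal
entries `a`, `b` of `ρ_A` satisfy `4ab ≤ (a + b)² = 1`. -/
theorem threeTangle_le_one {ψ : State 3} (h : IsUnitVector ψ) : threeTangle ψ ≤ 1 := by
  have hr (i : Fin 2) : reducedA ψ i i = ((∑ k, ∑ l, ‖ψ ![i, k, l]‖ ^ 2 : ℝ) : ℂ) := by
    simp [reducedA, Complex.mul_conj, Complex.normSq_eq_norm_sq]
  have hs : reducedA ψ 1 0 = star (reducedA ψ 0 1) := by
    simp [reducedA, mul_comm]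
  have hd : (reducedA ψ).det.re = (∑ k, ∑ l, ‖ψ ![0, k, l]‖ ^ 2) * (∑ k, ∑ l, ‖ψ ![1, k, l]‖ ^ 2)
      - ‖reducedA ψ 0 1‖ ^ 2 := by
    rw [Matrix.det_fin_two, hs, hr, hr, Complex.star_def, Complex.mul_conj,
      Complex.normSq_eq_norm_sq, ← Complex.ofReal_mul, ← Complex.ofReal_sub, Complex.ofReal_re]
  have h1 : ∑ k, ∑ l, ‖ψ ![0, k, l]‖ ^ 2 + ∑ k, ∑ l, ‖ψ ![1, k, l]‖ ^ 2 = 1 := by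
    rw [← h, sum_bitString]
    simp only [Fin.sum_univ_two]
    ring
  unfold threeTangle
  rw [hd]
  nlinarith [sq_nonneg (concurrence (reducedAB ψ)), sq_nonneg (concurrence (reducedAC ψ)),
    sq_nonneg ‖reducedA ψ 0 1‖,
    sq_nonneg (∑ k, ∑ l, ‖ψ ![0, k, l]‖ ^ 2 - ∑ k, ∑ l, ‖ψ ![1, k, l]‖ ^ 2)]

theorem reducedAC_eq_reducedAB {ψ : State 3} (h : ψ ∈ symmetricSector) :
    reducedAC ψ = reducedAB ψ := by
  have hs (a b c : Fin 2) : ψ ![a, b, c] = ψ ![a, c, b] := by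
    rw [← h (Equiv.swap 1 2) ![a, c, b]]
    congr 1
    ext i
    fin_cases i <;> rfl
  ext p q
  simp only [reducedAC, reducedAB, hs p.1 _ p.2, hs q.1 _ q.2]

/-- The state `c |000⟩ + s (|011⟩ + |101⟩ + |110⟩)`. -/
noncomputable def tangleState (c s : ℝ) : State 3 := ofDicke ![(c : ℂ), 0, 0, ((√3 : ℝ) : ℂ) * s]

theorem tangleState_apply (c s : ℝ) (x y z : Fin 2) : tangleState c s ![x, y, z] =
    if x + y + z = 0 then (if x = 0 ∧ y = 0 then (c : ℂ) else (s : ℂ)) else 0 := by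
  obtain ⟨⟨h0, h1⟩, ⟨h2, h3, h4⟩, ⟨h5, h6, h7⟩⟩ :=
    ofDicke_apply ![(c : ℂ), 0, 0, ((√3 : ℝ) : ℂ) * s]
  have h30 : ((√3 : ℝ) : ℂ) ≠ 0 := by simp
  rw [tangleState]
  fin_cases x <;> fin_cases y <;> fin_cases z <;>
    simp [h0, h1, h2, h3, h4, h5, h6, h7] <;> field_simp

theorem det_reducedA_tangleState (c s : ℝ) :
    (reducedA (tangleState c s)).det = ((2 * s ^ 2 * (c ^ 2 + s ^ 2) : ℝ) : ℂ) := by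
  rw [Matrix.det_fin_two]
  simp [reducedA, tangleState_apply]
  ring

theorem reindex_mul_spinFlip_tangleState (c s : ℝ) :
    Matrix.reindex finProdFinEquiv finProdFinEquiv
      (reducedAB (tangleState c s) * spinFlip (reducedAB (tangleState c s))) =
    !![2 * (c : ℂ) ^ 2 * s ^ 2, 0, 0, 2 * (c : ℂ) ^ 3 * s;
       0, 2 * (s : ℂ) ^ 4, 2 * (s : ℂ) ^ 4, 0;
       0, 2 * (s : ℂ) ^ 4, 2 * (s : ℂ) ^ 4, 0;
       2 * (c : ℂ) * s ^ 3, 0, 0, 2 * (c : ℂ) ^ 2 * s ^ 2] := by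
  have e0 : finProdFinEquiv.symm (0 : Fin (2 * 2)) = ((0, 0) : Fin 2 × Fin 2) := by decide
  have e1 : finProdFinEquiv.symm (1 : Fin (2 * 2)) = ((0, 1) : Fin 2 × Fin 2) := by decide
  have e2 : finProdFinEquiv.symm (2 : Fin (2 * 2)) = ((1, 0) : Fin 2 × Fin 2) := by decide
  have e3 : finProdFinEquiv.symm (3 : Fin (2 * 2)) = ((1, 1) : Fin 2 × Fin 2) := by decide
  have hρ : reducedAB (tangleState c s) = Matrix.of fun p q : Fin 2 × Fin 2 =>
      if p.1 + p.2 + (q.1 + q.2) = 0 then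
        (if p = 0 then (c : ℂ) else s) * (if q = 0 then (c : ℂ) else s) else 0 := by
    ext ⟨a, b⟩ ⟨a', b'⟩
    fin_cases a <;> fin_cases b <;> fin_cases a' <;> fin_cases b' <;>
      simp [reducedAB, tangleState_apply]
  rw [hρ]
  ext i j
  fin_cases i <;> fin_cases j <;>
    simp [spinFlip, Matrix.mul_apply, Fintype.sum_prod_type, Fin.sum_univ_two, e0, e1, e2, e3, σy]
  all_goals ring

/-- The blocks on `{00, 11}` and `{01, 10}` are singular, so their nonzero eigenvalues are the
traces `4c²s²` and `4s⁴`. -/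
theorem flipSpectrum_tangleState (c s : ℝ) :
    flipSpectrum (reducedAB (tangleState c s)) = {0, 0, 2 * |c| * |s|, 2 * s ^ 2} := by
  have hχ : (reducedAB (tangleState c s) * spinFlip (reducedAB (tangleState c s))).charpoly =
      (({0, 0, ((4 * c ^ 2 * s ^ 2 : ℝ) : ℂ), ((4 * s ^ 4 : ℝ) : ℂ)} : Multiset ℂ).map
        fun a => Polynomial.X - Polynomial.C a).prod := by
    rw [← Matrix.charpoly_reindex finProdFinEquiv, reindex_mul_spinFlip_tangleState,
      Matrix.charpoly, Matrix.det_succ_row_zero]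
    simp [Fin.sum_univ_succ, Matrix.det_fin_three, Matrix.charmatrix_apply, Fin.succAbove]
    have h2 : Polynomial.C (2 : ℂ) = 2 := map_ofNat _ 2
    have h4 : Polynomial.C (4 : ℂ) = 4 := map_ofNat _ 4
    rw [h2, h4]
    ring
  rw [flipSpectrum, hχ, Polynomial.roots_multiset_prod_X_sub_C]
  have h1 : √(4 * c ^ 2 * s ^ 2) = 2 * |c| * |s| := by
    rw [show 4 * c ^ 2 * s ^ 2 = (2 * |c| * |s|) ^ 2 by
      rw [mul_pow, mul_pow, sq_abs, sq_abs]; norm_num, Real.sqrt_sq (by positivity)]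
  have h2 : √(4 * s ^ 4) = 2 * s ^ 2 := by
    rw [show 4 * s ^ 4 = (2 * s ^ 2) ^ 2 by ring, Real.sqrt_sq (by positivity)]
  simp only [Multiset.insert_eq_cons, Multiset.map_cons, Multiset.map_singleton, Complex.ofReal_re,
    h1, h2, Complex.zero_re, Real.sqrt_zero]

theorem concurrence_tangleState (c s : ℝ) :
    concurrence (reducedAB (tangleState c s)) ^ 2 = 4 * s ^ 2 * (|c| - |s|) ^ 2 := by
  rw [concurrence, flipSpectrum_tangleState]
  have hx : 0 ≤ 2 * |c| * |s| := by positivity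
  have hs := sq_abs s
  simp only [Multiset.insert_eq_cons, Multiset.fold_cons_left, Multiset.fold_singleton,
    Multiset.sum_cons, Multiset.sum_singleton, zero_add]
  rw [← hs, max_eq_left (by positivity : 0 ≤ 2 * |s| ^ 2),
    max_eq_right (a := 0) (le_max_of_le_left hx), max_eq_right (a := 0) (le_max_of_le_left hx)]
  -- Only two values can be nonzero, so the concurrence is the absolute value of their difference.
  rcases le_total (2 * |c| * |s|) (2 * |s| ^ 2) with h | h
  · rw [max_eq_right h, max_eq_right (by linarith)]
    ring
  · rw [max_eq_left h, max_eq_right (by linarith)]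
    ring

theorem threeTangle_tangleState (c s : ℝ) :
    threeTangle (tangleState c s) = 16 * |c| * |s| ^ 3 := by
  rw [threeTangle, reducedAC_eq_reducedAB (ψ := tangleState c s) (ofDicke_mem_symmetricSector _),
    concurrence_tangleState, det_reducedA_tangleState, Complex.ofReal_re, ← sq_abs c, ← sq_abs s]
  ring

theorem threeTangle_family (θ : ℝ) : threeTangle (ofDicke (family θ)) =
    16 / (3 * √3) * |Real.cos θ * Real.sin θ ^ 3| := by
  have h3 : √3 ^ 3 = 3 * √3 := by rw [pow_succ, Real.sq_sqrt (by norm_num)]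
  have : ofDicke (family θ) = tangleState (Real.cos θ) (Real.sin θ / √3) := by
    have h30 : √3 ≠ 0 := by positivity
    rw [tangleState, family, ← Complex.ofReal_mul, mul_div_cancel₀ _ h30]
  rw [this, threeTangle_tangleState, abs_mul, abs_pow, abs_div, abs_of_pos (by positivity : 0 < √3),
    div_pow, h3]
  ring

theorem family_mem_setO (θ : ℝ) : family θ ∈ setO := by
  -- Here `e = (cos θ, sin θ)` and `f = (cos θ, -sin θ)`; the sign comes from the phase `π`.
  refine ⟨0, 0, θ, 0, Real.pi, θ, 0, ?_⟩
  ext i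
  fin_cases i <;> simp [family, phase, mul_comm Complex.I] <;> ring

theorem threeTangle_family_eq_one_iff (θ : ℝ) :
    threeTangle (ofDicke (family θ)) = 1 ↔ |Real.sin θ| = √3 / 2 := by
  have h3 : √3 ^ 2 = 3 := Real.sq_sqrt (by norm_num)
  have hcs := Real.cos_sq_add_sin_sq θ
  have hL : 0 ≤ threeTangle (ofDicke (family θ)) := by rw [threeTangle_family]; positivity
  have hsq : threeTangle (ofDicke (family θ)) ^ 2 =
      256 / 27 * ((1 - Real.sin θ ^ 2) * (Real.sin θ ^ 2) ^ 3) := by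
    rw [threeTangle_family, mul_pow, sq_abs, div_pow, mul_pow, mul_pow, h3, Real.cos_sq']
    ring
  rw [← pow_eq_one_iff_of_nonneg hL two_ne_zero, hsq,
    ← pow_left_inj₀ (abs_nonneg _) (by positivity : 0 ≤ √3 / 2) two_ne_zero, sq_abs, div_pow, h3]
  generalize Real.sin θ ^ 2 = x
  constructor
  · intro h
    -- The squared tangle is `256/27 (1 - x) x³`. Its maximum 1 at `x = 3/4` gives a double root;
    -- the cofactor is positive.
    have : (x - 3 / 4) ^ 2 * (x ^ 2 + x / 2 + 3 / 16) = 0 := by linear_combination (-27 / 256) * h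
    rcases mul_eq_zero.1 this with h | h
    · rw [sq_eq_zero_iff] at h
      linarith
    · nlinarith [sq_nonneg (x + 1 / 4)]
  · intro h
    rw [h]
    norm_num

theorem exists_threeTangle_eq_one : ∃ v ∈ setO, threeTangle (ofDicke v) = 1 := by
  refine ⟨family (Real.pi / 3), family_mem_setO _, (threeTangle_family_eq_one_iff _).2 ?_⟩
  rw [Real.sin_pi_div_three, abs_of_pos (by positivity)]

end IsingChain

theorem mainTheorem9 :
    -- the symmetric sector is spanned by the Dicke states and splits into `V₁` and `V₂`,
    -- which are invariant under the dynamics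
    (symmetricSector = Submodule.span ℂ (Set.range dicke) ∧
      V₁ ⊔ V₂ = symmetricSector ∧ V₁ ⊓ V₂ = ⊥ ∧
      (∀ (u : ℝ), ∀ ψ ∈ V₁, hamiltonian 3 u *ᵥ ψ ∈ V₁) ∧
      (∀ (u : ℝ), ∀ ψ ∈ V₂, hamiltonian 3 u *ᵥ ψ ∈ V₂)) ∧
    -- the reachable states from `|000⟩` are exactly those with coordinates in `setO`
    (∀ 𝒰 : Set (ℝ → ℝ),
      (∀ u : ℝ → ℝ, IsPiecewiseConstant u → (∀ t, u t = 0 ∨ u t = 1) → u ∈ 𝒰) →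
      reachableSet 3 𝒰 (ket 0 0 0) = ofDicke '' setO) ∧
    -- they are symmetric states, but not all symmetric states, even up to a global phase
    (ofDicke '' setO ⊆ {ψ | ψ ∈ symmetricSector ∧ IsUnitVector ψ} ∧
      ∃ ψ ∈ symmetricSector, IsUnitVector ψ ∧
        ∀ c : ℂ, ‖c‖ = 1 → c • ψ ∉ ofDicke '' setO) ∧
    -- equal coefficients in the decomposition along `V₁` and `V₂`
    ((∀ v : Fin 4 → ℂ, v ∈ setO ↔
        ∃ e₁ e₂ : Fin 2 → ℂ, IsUnitVector e₁ ∧ IsUnitVector e₂ ∧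
          v = ((1 / √2 : ℝ) : ℂ) • tensor e₁ fPlus + ((1 / √2 : ℝ) : ℂ) • tensor e₂ fMinus) ∧
      (∀ v ∈ setO, ∀ (e₁ e₂ : Fin 2 → ℂ) (r₁ r₂ : ℝ), IsUnitVector e₁ → IsUnitVector e₂ →
        0 ≤ r₁ → 0 ≤ r₂ → v = (r₁ : ℂ) • tensor e₁ fPlus + (r₂ : ℂ) • tensor e₂ fMinus →
        r₁ = r₂ ∧ r₁ = 1 / √2)) ∧
    -- the three-tangle is at most 1, and this value is attained on the reachable set
    ((∀ ψ : State 3, IsUnitVector ψ → threeTangle ψ ≤ 1) ∧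
      (∀ θ : ℝ, family θ ∈ setO ∧
        threeTangle (ofDicke (family θ)) =
          16 / (3 * √3) * |Real.cos θ * Real.sin θ ^ 3| ∧
        (threeTangle (ofDicke (family θ)) = 1 ↔ |Real.sin θ| = √3 / 2)) ∧
      ∃ v ∈ setO, threeTangle (ofDicke v) = 1) := by
  refine ⟨⟨symmetricSector_eq_span, V₁_sup_V₂, V₁_inf_V₂,
      fun u _ h => hamiltonian_mulVec_mem_V₁ u h, fun u _ h => hamiltonian_mulVec_mem_V₂ u h⟩,
    fun 𝒰 h => reachableSet_eq fun u hu => h u hu.1 hu.2,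
    ⟨?_, exists_symmetric_notMem⟩, ⟨fun v => mem_setO_iff v, ?_⟩,
    ⟨fun _ h => threeTangle_le_one h, fun θ => ⟨family_mem_setO θ, threeTangle_family θ,
      threeTangle_family_eq_one_iff θ⟩, exists_threeTangle_eq_one⟩⟩
  · rintro _ ⟨v, hv, rfl⟩
    exact ⟨ofDicke_mem_symmetricSector v,
      (isUnitVector_ofDicke v).2 (isUnitVector_of_mem_setO hv)⟩
  · rintro v hv e f r s he hf hr hs rfl
    exact eq_inv_sqrt_two_of_mem_setO he hf hr hs hv
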